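/- Let $d\ge 1$ and let $\mathbb T^d=\mathbb R^d/\mathbb Z^d$. A triangulation of $\mathbb T^d$ is a finite simplicial complex whose carrier is a topological $d$-manifold (without boundary) embedded in $\mathbb T^d$. For a vertex $p$ of a complex $K$, the link of $p$ in $K$ is the complex of all simplices $\sigma\in K$ with $p\notin\sigma$ and $\sigma\cup\{p\}\in K$. A complex is a $k$-pseudomanifold if it is a pure $k$-complex (every simplex is a face of some $k$-simplex) and every $(k-1)$-simplex is a face of exactly two $k$-simplices. Here the empty set counts as a $(-1)$-simplex of every complex; thus a pure $k$-complex contains at least one $k$-simplex, and a $0$-pseudomanifold consists of exactly two points. (Pseudomanifold criterion.) Let $K$ be a triangulation of $\mathbb T^d$ and let $J\subseteq K$ be a subcomplex with the same vertex set as $K$. Then $J=K$ if and only if for every vertex $p$ of $J$ the link of $p$ in $J$ is a $(d-1)$-pseudomanifold. -/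

import Mathlib

/- Abstract simplicial complexes are Mathlib's `PreAbstractSimplicialComplex V`: downward closed
families of nonempty finite sets of vertices. A simplex with `k + 1` vertices has dimension `k`. -/

namespace PreAbstractSimplicialComplex

variable {V : Type*}

/-- The vertices of a complex. -/
def vertices (K : PreAbstractSimplicialComplex V) : Set V :=
  {v | {v} ∈ K.faces}

/-- All simplices of `K`, including the empty simplex, which has dimension `-1`. -/
def simplices (K : PreAbstractSimplicialComplex V) : Set (Finset V) :=
  insert ∅ K.faces

/-- The link of `v` in `K`: the simplices `s` not containing `v` such that `s ∪ {v}` is a simplex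
of `K`. -/
def link (K : PreAbstractSimplicialComplex V) (v : V) : PreAbstractSimplicialComplex V where
  faces := {s | s.Nonempty ∧ ∃ h : v ∉ s, Finset.cons v s h ∈ K.faces}
  isRelLowerSet_faces := by
    rintro s ⟨hs, hv, hsK⟩
    refine ⟨hs, fun t hts ht => ⟨ht, fun h => hv (hts h), ?_⟩⟩
    exact (K.isRelLowerSet_faces hsK).2 (Finset.cons_subset_cons.2 hts) (Finset.cons_nonempty _)

/-- `K` is a pure `k`-complex: every simplex is a face of a `k`-simplex of `K`. Since the empty
simplex is included, a pure `k`-complex contains at least one `k`-simplex. -/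
def IsPure (K : PreAbstractSimplicialComplex V) (k : ℕ) : Prop :=
  ∀ s ∈ K.simplices, ∃ t ∈ K.faces, s ⊆ t ∧ t.card = k + 1

/-- `K` is a `k`-pseudomanifold: it is a pure `k`-complex and every `(k - 1)`-simplex is a face of
exactly two `k`-simplices. (For `k = 0` the only `(k - 1)`-simplex is the empty one, so that a
`0`-pseudomanifold consists of exactly two points.) -/
def IsPseudomanifold (K : PreAbstractSimplicialComplex V) (k : ℕ) : Prop :=
  K.IsPure k ∧
    ∀ s ∈ K.simplices, s.card = k → {t | t ∈ K.faces ∧ s ⊆ t ∧ t.card = k + 1}.encard = 2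

/-- Every vertex link of `K` is a `(d - 1)`-pseudomanifold; used for `1 ≤ d` only. -/
def HasGoodLinks (K : PreAbstractSimplicialComplex V) (d : ℕ) : Prop :=
  ∀ v ∈ K.vertices, (K.link v).IsPseudomanifold (d - 1)

/-- The carrier (geometric realization) of `K` in barycentric coordinates. It is used for finite
complexes, where the subspace topology of `V → ℝ` is the usual topology of the carrier. -/
def carrier (K : PreAbstractSimplicialComplex V) : Set (V → ℝ) :=
  {x | ∃ s ∈ K.faces, (∀ v, 0 ≤ x v) ∧ (∀ v, v ∉ s → x v = 0) ∧ ∑ v ∈ s, x v = 1}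

/-- `K` is a triangulation of the torus `𝕋ᵈ = ℝᵈ / ℤᵈ`: a finite simplicial complex whose carrier
is a topological `d`-manifold (without boundary) and is topologically embedded in `𝕋ᵈ`.
The carrier of a finite complex is automatically Hausdorff and second countable, so being a
manifold amounts to being covered by charts onto open subsets of `ℝᵈ`. -/
structure IsTorusTriangulation (K : PreAbstractSimplicialComplex V) (d : ℕ) : Prop where
  finite : K.faces.Finite
  manifold : Nonempty (ChartedSpace (EuclideanSpace ℝ (Fin d)) K.carrier)
  embedded : ∃ f : K.carrier → UnitAddTorus (Fin d), Topology.IsEmbedding f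

end PreAbstractSimplicialComplex

/-! Both directions are local and rest on invariance of domain in the manifold carrying `K`.

Suppose `J = K`. Two `d`-simplices sharing a facet glue to an injective copy of an open piece of
`ℝᵈ`, so they already fill a neighborhood of interior points of the facet; no other `d`-simplex
contains the facet, and no simplex has more than `d + 1` vertices. If all simplices around `s` lie
in one simplex with at most `d + 1` vertices, a neighborhood in the carrier embeds in `ℝᵈ`; were `s`
of dimension below `d`, its image would lie in a half-space with a point of `s` on the boundary. So
maximal simplices have dimension `d`, and a facet lies in at least two of them. Adding the vertex
`p` transfers this to links.

Conversely, if the link of `p` in `J` is a pseudomanifold, the `d`-simplices of `J` at `p` form a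
cone over a nonzero mod 2 cycle. Such a cone in a `d`-manifold is a neighborhood of its apex
(`image_cone_mem_nhds`). Every simplex of `K` at `p` has interior points arbitrarily near `p`; one
of them lies in a `d`-simplex of `J`, which therefore contains the whole simplex.

The analytic core needs no homology theory. Collapsing the cone onto a simplex gives a map of odd
degree vanishing only at the apex, and a mod 2 Sperner lemma on iterated barycentric subdivisions
shows that every nearby map has a zero. If an embedding in `ℝᵈ` missed points near the image of the
apex, a nearby map without zeros could be built (`range_mem_nhds_of_stable_zero`). For a single
simplex the same argument yields invariance of domain itself. -/

namespace ModTwoChain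
open MvPolynomial Finset

/-! ### Mod 2 chains as polynomials. -/

/-- The boundary operator on mod 2 chains. A monomial in the variables `X v` stands for an
(unordered, possibly degenerate) simplex, and the boundary is the derivation with `X v ↦ 1`. -/
noncomputable def boundary (σ : Type*) :
    Derivation (ZMod 2) (MvPolynomial σ (ZMod 2)) (MvPolynomial σ (ZMod 2)) :=
  mkDerivation (ZMod 2) fun _ => 1

variable {σ τ : Type*}

@[simp] lemma boundary_X (i : σ) : boundary σ (X i) = 1 := mkDerivation_X _ _ _

@[simp] lemma boundary_C (a : ZMod 2) : boundary σ (C a) = 0 := derivation_C _ _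

lemma boundary_X_mul (i : σ) (p : MvPolynomial σ (ZMod 2)) :
    boundary σ (X i * p) = X i * boundary σ p + p := by
  simp [Derivation.leibniz]

lemma boundary_boundary (p : MvPolynomial σ (ZMod 2)) : boundary σ (boundary σ p) = 0 := by
  induction p using MvPolynomial.induction_on with
  | C a => simp
  | add p q hp hq => simp [hp, hq]
  | mul_X p i hp =>
    rw [mul_comm, boundary_X_mul, map_add, boundary_X_mul, hp, mul_zero, zero_add,
      CharTwo.add_self_eq_zero]

lemma boundary_rename (f : σ → τ) (p : MvPolynomial σ (ZMod 2)) :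
    boundary τ (rename f p) = rename f (boundary σ p) := by
  induction p using MvPolynomial.induction_on with
  | C a => simp
  | add p q hp hq => simp [hp, hq]
  | mul_X p i hp =>
    rw [mul_comm, map_mul, rename_X, boundary_X_mul, boundary_X_mul, hp]
    simp

lemma boundary_monomial (m : σ →₀ ℕ) :
    boundary σ (monomial m 1) =
      ∑ i ∈ m.support, monomial (m - Finsupp.single i 1) (m i : ZMod 2) := by
  simp [boundary, mkDerivation_monomial, Finsupp.sum]

lemma boundary_prod [DecidableEq σ] (s : Finset σ) :
    boundary σ (∏ i ∈ s, X i) = ∑ i ∈ s, ∏ j ∈ s.erase i, X j := by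
  induction s using Finset.induction_on with
  | empty => simp
  | insert a s ha ih =>
    rw [prod_insert ha, boundary_X_mul, ih, sum_insert ha, erase_insert ha, add_comm, mul_sum]
    congr 1
    refine sum_congr rfl fun i hi => ?_
    have : a ≠ i := fun h => ha (h ▸ hi)
    rw [erase_insert_of_ne this, prod_insert (by simp [ha])]

/-- The exponent vector of a squarefree monomial. -/
noncomputable def expo (s : Finset σ) : σ →₀ ℕ := ∑ i ∈ s, Finsupp.single i 1

lemma expo_apply [DecidableEq σ] (s : Finset σ) (i : σ) : expo s i = if i ∈ s then 1 else 0 := by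
  simp [expo, Finsupp.finsetSum_apply, Finsupp.single_apply]

lemma expo_insert [DecidableEq σ] {s : Finset σ} {i : σ} (hi : i ∉ s) :
    expo (insert i s) = expo s + Finsupp.single i 1 := by
  rw [expo, sum_insert hi, add_comm]; rfl

lemma support_expo (s : Finset σ) : (expo s).support = s := by
  classical
  ext i
  simp [expo_apply]

lemma prod_X_eq (s : Finset σ) :
    (∏ i ∈ s, X i : MvPolynomial σ (ZMod 2)) = monomial (expo s) 1 := by
  classical
  induction s using Finset.induction_on with
  | empty => simp [expo]
  | insert a s ha ih =>
    rw [prod_insert ha, ih, expo_insert ha, X, monomial_mul, add_comm, one_mul]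

/-- Degenerate simplices do not disturb the count: a squarefree term can come from a monomial with a
square `X j ^ 2` only with coefficient `2 = 0`. -/
lemma coeff_boundary [Fintype σ] [DecidableEq σ] (T : Finset σ) (q : MvPolynomial σ (ZMod 2)) :
    coeff (expo T) (boundary σ q) = ∑ j ∈ Tᶜ, coeff (expo (insert j T)) q := by
  induction q using MvPolynomial.induction_on' with
  | add p q hp hq => simp [hp, hq, sum_add_distrib]
  | monomial m a =>
    have ha : monomial m a = a • (monomial m 1 : MvPolynomial σ (ZMod 2)) := by
      rw [smul_monomial, smul_eq_mul, mul_one]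
    rw [ha, Derivation.map_smul]
    simp only [coeff_smul, ← smul_sum]
    congr 1
    have h1 : boundary σ (monomial m 1) =
        ∑ i, monomial (m - Finsupp.single i 1) (m i : ZMod 2) := by
      rw [boundary_monomial]
      refine sum_subset (subset_univ _) fun i _ hi => ?_
      rw [Finsupp.notMem_support_iff.1 hi]
      simp
    rw [h1, coeff_sum, ← sum_subset (subset_univ Tᶜ)]
    · refine sum_congr rfl fun j hj => ?_
      have hj' : j ∉ T := by simpa using hj
      rw [coeff_monomial, coeff_monomial, expo_insert hj']
      by_cases hm : m = expo T + Finsupp.single j 1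
      · have : m j = 1 := by rw [hm]; simp [expo_apply, hj']
        rw [if_pos hm, if_pos (by rw [hm]; simp), this, Nat.cast_one]
      · rw [if_neg hm]
        split_ifs with h2
        · by_cases h0 : m j = 0
          · simp [h0]
          · refine absurd ?_ hm
            rw [← h2, tsub_add_cancel_of_le]
            simpa using Nat.one_le_iff_ne_zero.2 h0
        · rfl
    · intro j _ hj
      have hj' : j ∈ T := by simpa using hj
      rw [coeff_monomial]
      split_ifs with h2
      · have h3 : m j - 1 = 1 := by
          have := DFunLike.congr_fun h2 j
          simpa [expo_apply, hj'] using this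
        have h4 : m j = 2 := by omega
        rw [h4]; rfl
      · rfl

lemma rename_prod_X (f : σ → τ) (s : Finset σ) :
    rename f (∏ i ∈ s, X i : MvPolynomial σ (ZMod 2)) = ∏ i ∈ s, X (f i) := by
  simp [map_prod]

/-! ### Subdivision and Sperner's lemma. -/

/-- Subdivision of `k`-point simplices: cone off the subdivided boundary from the point
`b m`. -/
noncomputable def subdiv (b : (σ →₀ ℕ) → σ) :
    ℕ → MvPolynomial σ (ZMod 2) →ₗ[ZMod 2] MvPolynomial σ (ZMod 2)
  | 0 => LinearMap.id
  | k + 1 => (basisMonomials σ (ZMod 2)).constr (ZMod 2) fun m =>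
      X (b m) * subdiv b k (boundary σ (monomial m 1))

lemma subdiv_succ_monomial (b : (σ →₀ ℕ) → σ) (k : ℕ) (m : σ →₀ ℕ) :
    subdiv b (k + 1) (monomial m 1) = X (b m) * subdiv b k (boundary σ (monomial m 1)) := by
  have := (basisMonomials σ (ZMod 2)).constr_basis (ZMod 2) (fun m =>
      X (b m) * subdiv b k (boundary σ (monomial m 1))) m
  rwa [coe_basisMonomials] at this

/-- The Leibniz rule for a cone leaves its base plus the cone over the boundary of the base. By
induction the latter involves `∂∂ = 0`, so subdivision is a chain map for any choice of cone points.
-/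
lemma boundary_subdiv (b : (σ →₀ ℕ) → σ) (k : ℕ) (p : MvPolynomial σ (ZMod 2)) :
    boundary σ (subdiv b (k + 1) p) = subdiv b k (boundary σ p) := by
  suffices h : (boundary σ).toLinearMap ∘ₗ subdiv b (k + 1) =
      subdiv b k ∘ₗ (boundary σ).toLinearMap from LinearMap.congr_fun h p
  refine (basisMonomials σ (ZMod 2)).ext fun m => ?_
  rw [coe_basisMonomials]
  change boundary σ (subdiv b (k + 1) (monomial m 1)) = subdiv b k (boundary σ (monomial m 1))
  rw [subdiv_succ_monomial, boundary_X_mul]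
  cases k with
  | zero => simp [subdiv, boundary_boundary]
  | succ k => simp [boundary_subdiv b k, boundary_boundary]

lemma boundary_subdiv_pow (b : (σ →₀ ℕ) → σ) (k N : ℕ) (p : MvPolynomial σ (ZMod 2)) :
    boundary σ ((subdiv b (k + 1) ^ N) p) = (subdiv b k ^ N) (boundary σ p) := by
  induction N with
  | zero => simp
  | succ N ih => rw [pow_succ', pow_succ', Module.End.mul_apply, Module.End.mul_apply,
      boundary_subdiv, ih]

lemma coeff_expo_rename_eq_zero [DecidableEq τ] (f : σ → τ) (U T : Finset τ)
    (p : MvPolynomial σ (ZMod 2)) (hp : ∀ m ∈ p.support, ∀ x ∈ m.support, f x ∈ U)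
    (hT : ¬ T ⊆ U) : coeff (expo T) (rename f p) = 0 := by
  classical
  by_contra h
  obtain ⟨u, hu, hup⟩ := coeff_rename_ne_zero f p _ h
  refine hT fun i hi => ?_
  rw [← support_expo T, ← hu] at hi
  obtain ⟨x, hx, rfl⟩ := mem_image.1 (Finsupp.mapDomain_support hi)
  exact hp u (mem_support_iff.2 hup) x hx

/-- A Sperner labelling of the iterated subdivision of a simplex has an odd number of fully
labelled simplices. -/
lemma coeff_rename_subdiv_pow {W E L : Type*} [Fintype L] [DecidableEq L] [DecidableEq W]
    (b : (E →₀ ℕ) → E) (e : W → E) (φ : W → L) (lab : E → L) (N : ℕ) (s : Finset W)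
    (hlab : ∀ s' ⊆ s, ∀ m ∈ ((subdiv b s'.card ^ N) (∏ w ∈ s', X (e w))).support,
      ∀ x ∈ m.support, lab x ∈ s'.image φ) (hφ : Set.InjOn φ s) :
    coeff (expo (s.image φ)) (rename lab ((subdiv b s.card ^ N) (∏ w ∈ s, X (e w)))) = 1 := by
  induction s using Finset.induction_on with
  | empty =>
    have : subdiv b 0 ^ N = LinearMap.id := by
      change (1 : Module.End _ _) ^ N = 1
      exact one_pow N
    simp [expo, this]
  | insert a s ha ih =>
    have ha' : φ a ∉ s.image φ := by
      intro h
      obtain ⟨w, hw, hwa⟩ := mem_image.1 h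
      have := hφ (by simp [hw]) (by simp) hwa
      exact ha (this ▸ hw)
    have hφs : Set.InjOn φ s := hφ.mono (by simp)
    have ih' := ih (fun s' hs' => hlab s' (hs'.trans (subset_insert a s))) hφs
    set q := rename lab ((subdiv b (insert a s).card ^ N) (∏ w ∈ insert a s, X (e w))) with hq
    -- Sperner's double count: `h1` computes the number, mod 2, of facets labelled by `s.image φ` in
    -- the boundary. As only labels from the whole simplex occur, just the extra label `φ a`
    -- survives on the right; as subdivision commutes with the boundary, just the face `s`
    -- contributes on the left.
    have h1 := coeff_boundary (s.image φ) q
    rw [sum_eq_single (φ a)] at h1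
    · rw [image_insert, ← h1, hq, boundary_rename, card_insert_of_notMem ha, boundary_subdiv_pow,
        ← rename_prod_X, boundary_rename, boundary_prod, map_sum, map_sum, map_sum, coeff_sum,
        sum_insert ha, erase_insert ha, rename_prod_X, ih', add_eq_left]
      refine sum_eq_zero fun i hi => ?_
      have hai : a ≠ i := fun h => ha (h ▸ hi)
      have hia : i ∈ insert a s := mem_insert_of_mem hi
      have hcard : ((insert a s).erase i).card = s.card := by
        rw [card_erase_of_mem hia, card_insert_of_notMem ha, Nat.add_sub_cancel]
      rw [rename_prod_X, ← hcard]
      refine coeff_expo_rename_eq_zero lab _ _ _ (hlab _ (erase_subset _ _)) fun h => ?_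
      obtain ⟨w, hw, hwi⟩ := mem_image.1 (h (mem_image_of_mem φ hi))
      have hw' := mem_erase.1 hw
      exact hw'.1 (hφ (by simpa using hw'.2) (by simp [hi]) hwi)
    · intro j _ hj
      refine coeff_expo_rename_eq_zero lab _ _ _ (hlab _ subset_rfl) fun h => ?_
      have := h (mem_insert_self j _)
      rw [image_insert, mem_insert] at this
      rcases this with h2 | h2
      · exact hj h2
      · simp_all
    · intro h
      simp [ha'] at h

/-- A mod 2 chain with a Sperner labelled boundary has a fully labelled simplex in each iterated
subdivision. -/
lemma exists_fully_labelled {W E : Type*} [DecidableEq W] {d : ℕ}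
    (b : (E →₀ ℕ) → E) (e : W → E) (φ : W → Fin (d + 1)) (lab : E → Fin (d + 1)) (N : ℕ)
    (A B : Finset (Finset W))
    (hAB : boundary W (∑ t ∈ A, ∏ w ∈ t, X w) = ∑ s ∈ B, ∏ w ∈ s, X w)
    (hB : ∀ s ∈ B, s.card = d)
    (hodd : Odd ({s ∈ B | s.image φ = univ.erase 0} : Finset (Finset W)).card)
    (hlab : ∀ s ∈ B, ∀ s' ⊆ s, ∀ m ∈ ((subdiv b s'.card ^ N) (∏ w ∈ s', X (e w))).support,
      ∀ x ∈ m.support, lab x ∈ s'.image φ) :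
    ∃ t ∈ A, ∃ m ∈ ((subdiv b (d + 1) ^ N) (∏ w ∈ t, X (e w))).support,
      ∀ i, ∃ x ∈ m.support, lab x = i := by
  by_contra hcon
  push Not at hcon
  have hzero : coeff (expo univ) (rename lab ((subdiv b (d + 1) ^ N)
      (∑ t ∈ A, ∏ w ∈ t, X (e w)))) = 0 := by
    rw [map_sum, map_sum, coeff_sum]
    refine sum_eq_zero fun t ht => ?_
    by_contra h
    obtain ⟨u, hu, hup⟩ := coeff_rename_ne_zero lab _ _ h
    obtain ⟨i, hi⟩ := hcon t ht u (mem_support_iff.2 hup)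
    have : i ∈ (Finsupp.mapDomain lab u).support := by rw [hu, support_expo]; simp
    obtain ⟨x, hx, hxi⟩ := mem_image.1 (Finsupp.mapDomain_support this)
    exact hi x hx hxi
  -- Without a fully labelled simplex the coefficient vanishes, whereas the boundary contributes 1
  -- for each `s ∈ B` labelled exactly by the nonzero labels, an odd number in all.
  have hc := coeff_boundary (univ.erase 0) (rename lab ((subdiv b (d + 1) ^ N)
      (∑ t ∈ A, ∏ w ∈ t, X (e w))))
  have hAB' : boundary E (∑ t ∈ A, ∏ w ∈ t, X (e w)) = ∑ s ∈ B, ∏ w ∈ s, X (e w) := by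
    have := congrArg (rename e) hAB
    simpa [← boundary_rename, map_prod] using this
  have hcompl : (univ.erase 0 : Finset (Fin (d + 1)))ᶜ = {0} := by
    ext i; simp
  rw [hcompl, sum_singleton, insert_erase (mem_univ _), hzero, boundary_rename,
    boundary_subdiv_pow, hAB', map_sum, map_sum, coeff_sum] at hc
  have hval : ∀ s ∈ B, coeff (expo (univ.erase 0)) (rename lab ((subdiv b d ^ N)
      (∏ w ∈ s, X (e w)))) = if s.image φ = univ.erase 0 then 1 else 0 := by
    intro s hs
    have hcard : (univ.erase (0 : Fin (d + 1))).card = d := by simp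
    have hs0 := hlab s hs s subset_rfl
    rw [hB s hs] at hs0
    split_ifs with h
    · have := coeff_rename_subdiv_pow b e φ lab N s (hlab s hs)
        (by rw [← card_image_iff, h, hcard, hB s hs])
      rwa [hB s hs, h] at this
    · refine coeff_expo_rename_eq_zero lab _ _ _ hs0 fun h' => h ?_
      exact (eq_of_subset_of_card_le h' (by
        rw [hcard]; exact card_image_le.trans (hB s hs).le)).symm
  rw [sum_congr rfl hval, ← sum_filter, sum_const, nsmul_one] at hc
  have h1 := (ZMod.natCast_eq_one_iff_odd).2 hodd
  rw [h1] at hc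
  exact one_ne_zero hc

/-! ### Mesh of iterated barycentric subdivisions. -/

variable {E : Type*} [NormedAddCommGroup E] [NormedSpace ℝ E]

/-- The barycenter of a monomial in points of a vector space. -/
noncomputable def barycenter (m : E →₀ ℕ) : E :=
  (m.degree : ℝ)⁻¹ • m.sum fun x n => (n : ℝ) • x

/-- Monomials of degree `k` with all variables in `S` and at pairwise distance at most `r`. -/
def fineSimplices (S : Set E) (r : ℝ) (k : ℕ) : Set (E →₀ ℕ) :=
  {m | m.degree = k ∧ ↑m.support ⊆ S ∧ ∀ x ∈ m.support, ∀ y ∈ m.support, dist x y ≤ r}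

lemma barycenter_mem_convexHull {m : E →₀ ℕ} (hm : m.degree ≠ 0) :
    barycenter m ∈ convexHull ℝ (m.support : Set E) := by
  have h := (convex_convexHull ℝ (m.support : Set E)).sum_mem
    (t := m.support) (w := fun x => (m.degree : ℝ)⁻¹ * (m x : ℝ)) (z := id)
    (fun i _ => by positivity)
    (by
      rw [← mul_sum, ← Nat.cast_sum]
      exact inv_mul_cancel₀ (by exact_mod_cast hm))
    (fun i hi => subset_convexHull ℝ _ hi)
  convert h using 1
  simp [barycenter, Finsupp.sum, smul_sum, mul_smul]

/-- In the average of the `k + 1` vectors `y - x`, counted with multiplicity, at least one is zero,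
so at most `k` terms of norm at most `r` remain. -/
lemma dist_barycenter_le {S : Set E} {r : ℝ} {k : ℕ} {m : E →₀ ℕ}
    (hm : m ∈ fineSimplices S r (k + 1)) {x : E} (hx : x ∈ m.support) :
    dist x (barycenter m) ≤ k / (k + 1) * r := by
  classical
  obtain ⟨hdeg, -, hdist⟩ := hm
  have hk : (0 : ℝ) < k + 1 := by positivity
  have hsum : ∑ y ∈ m.support, (m y : ℝ) = k + 1 := by
    rw [← Nat.cast_sum]
    exact_mod_cast hdeg
  have h1 : barycenter m - x = (k + 1 : ℝ)⁻¹ • ∑ y ∈ m.support, (m y : ℝ) • (y - x) := by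
    simp only [smul_sub, sum_sub_distrib, ← sum_smul, hsum]
    rw [inv_smul_smul₀ hk.ne', barycenter, hdeg, Finsupp.sum]
    push_cast
    rfl
  have h2 : ∑ y ∈ m.support.erase x, (m y : ℝ) ≤ k := by
    have := add_sum_erase m.support (fun y => (m y : ℝ)) hx
    have h1 : (1 : ℝ) ≤ m x := by
      exact_mod_cast Nat.one_le_iff_ne_zero.2 (Finsupp.mem_support_iff.1 hx)
    linarith
  have hr : 0 ≤ r := (dist_self x).symm.le.trans (hdist x hx x hx)
  rw [dist_comm, dist_eq_norm, h1, norm_smul, Real.norm_of_nonneg (by positivity)]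
  have h3 : ‖∑ y ∈ m.support, (m y : ℝ) • (y - x)‖ ≤ k * r := by
    rw [← add_sum_erase _ _ hx, sub_self, smul_zero, zero_add]
    calc _ ≤ ∑ y ∈ m.support.erase x, ‖(m y : ℝ) • (y - x)‖ := norm_sum_le _ _
      _ ≤ ∑ y ∈ m.support.erase x, (m y : ℝ) * r := by
        refine sum_le_sum fun y hy => ?_
        rw [norm_smul, Real.norm_of_nonneg (by positivity), ← dist_eq_norm]
        exact mul_le_mul_of_nonneg_left (hdist y (mem_of_mem_erase hy) x hx) (by positivity)
      _ ≤ k * r := by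
        rw [← sum_mul]
        exact mul_le_mul_of_nonneg_right h2 hr
  calc _ ≤ (k + 1 : ℝ)⁻¹ * (k * r) := mul_le_mul_of_nonneg_left h3 (by positivity)
    _ = _ := by ring

/-- The faces are subdivided inside the convex hull of the simplex, and convexity of balls extends
the distance bound for the barycenter from the vertices to that hull. The bound `k / (k + 1) ≤ n /
(n + 1)` gives one contraction factor for all dimensions. -/
lemma subdiv_mem_restrictSupport {n : ℕ} {S : Set E} (hS : Convex ℝ S) {r : ℝ} (hr : 0 ≤ r)
    {k : ℕ} (hk : k ≤ n + 1) {m : E →₀ ℕ} (hm : m ∈ fineSimplices S r k) :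
    subdiv barycenter k (monomial m 1) ∈
      restrictSupport (ZMod 2) (fineSimplices S (n / (n + 1) * r) k) := by
  induction k generalizing m S with
  | zero =>
    have : m = 0 := (Finsupp.degree_eq_zero_iff m).1 hm.1
    subst this
    simp [subdiv, fineSimplices, mem_restrictSupport_iff, support_one]
  | succ k ih =>
    set S' := convexHull ℝ (m.support : Set E)
    have hS' : S' ⊆ S := convexHull_min hm.2.1 hS
    have hb : barycenter m ∈ S' := barycenter_mem_convexHull (by rw [hm.1]; omega)
    have hle : (k : ℝ) / (k + 1) * r ≤ n / (n + 1) * r := by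
      refine mul_le_mul_of_nonneg_right ?_ hr
      have : (k : ℝ) ≤ n := by exact_mod_cast Nat.le_of_succ_le_succ hk
      rw [div_le_div_iff₀ (by positivity) (by positivity)]
      nlinarith
    have hball : ∀ y ∈ S', dist y (barycenter m) ≤ n / (n + 1) * r := by
      have : S' ⊆ Metric.closedBall (barycenter m) (n / (n + 1) * r) :=
        convexHull_min (fun x hx => (dist_barycenter_le hm hx).trans hle) (convex_closedBall _ _)
      exact this
    have hface : subdiv barycenter k (boundary E (monomial m 1)) ∈
        restrictSupport (ZMod 2) (fineSimplices S' (n / (n + 1) * r) k) := by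
      rw [boundary_monomial, map_sum]
      refine Submodule.sum_mem _ fun x hx => ?_
      have : (monomial (m - Finsupp.single x 1)) (m x : ZMod 2) =
          (m x : ZMod 2) • (monomial (m - Finsupp.single x 1) (1 : ZMod 2)) := by
        rw [smul_monomial, smul_eq_mul, mul_one]
      rw [this, map_smul]
      refine Submodule.smul_mem _ _ (ih (convex_convexHull ℝ _) (by omega) ?_)
      have hx1 : Finsupp.single x 1 ≤ m := by
        simpa using Nat.one_le_iff_ne_zero.2 (Finsupp.mem_support_iff.1 hx)
      have hsub : (m - Finsupp.single x 1).support ⊆ m.support :=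
        Finsupp.support_mono tsub_le_self
      refine ⟨?_, fun y hy => subset_convexHull ℝ _ (hsub hy),
        fun y hy z hz => hm.2.2 y (hsub hy) z (hsub hz)⟩
      have h1 : (m - Finsupp.single x 1 + Finsupp.single x 1).degree = k + 1 := by
        rw [tsub_add_cancel_of_le hx1, hm.1]
      rw [map_add, Finsupp.degree_single] at h1
      omega
    rw [subdiv_succ_monomial, mem_restrictSupport_iff]
    intro u hu
    rw [SetLike.mem_coe, support_X_mul, mem_map] at hu
    obtain ⟨u', hu', rfl⟩ := hu
    obtain ⟨h1, h2, h3⟩ := (mem_restrictSupport_iff _).1 hface hu'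
    have hmem : ∀ y ∈ (Finsupp.single (barycenter m) 1 + u').support,
        y = barycenter m ∨ y ∈ u'.support := by
      classical
      intro y hy
      rcases mem_union.1 (Finsupp.support_add hy) with h | h
      · exact Or.inl (by simpa using Finsupp.support_single_subset h)
      · exact Or.inr h
    refine ⟨by simp [h1, add_comm], fun y hy => ?_, fun y hy z hz => ?_⟩
    · rcases hmem y hy with rfl | h
      · exact hS' hb
      · exact hS' (h2 h)
    · rcases hmem y hy with rfl | h <;> rcases hmem z hz with rfl | h'
      · rw [dist_self]; positivity
      · rw [dist_comm]; exact hball z (h2 h')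
      · exact hball y (h2 h)
      · exact h3 y h z h'

lemma subdiv_pow_mem_restrictSupport {n : ℕ} {S : Set E} (hS : Convex ℝ S) {r : ℝ} (hr : 0 ≤ r)
    {k : ℕ} (hk : k ≤ n + 1) {m : E →₀ ℕ} (hm : m ∈ fineSimplices S r k) (N : ℕ) :
    (subdiv barycenter k ^ N) (monomial m 1) ∈
      restrictSupport (ZMod 2) (fineSimplices S ((n / (n + 1)) ^ N * r) k) := by
  induction N with
  | zero => simpa using hm
  | succ N ih =>
    rw [pow_succ' (subdiv barycenter k), Module.End.mul_apply]
    rw [restrictSupport_eq_span] at ih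
    generalize (subdiv barycenter k ^ N) (monomial m 1) = p at ih
    induction ih using Submodule.span_induction with
    | mem x hx =>
      obtain ⟨u, hu, rfl⟩ := hx
      have := subdiv_mem_restrictSupport (n := n) hS (by positivity) hk hu
      rwa [← mul_assoc, ← pow_succ'] at this
    | zero => rw [map_zero]; exact Submodule.zero_mem _
    | add x y _ _ hx hy => rw [map_add]; exact Submodule.add_mem _ hx hy
    | smul a x _ hx => rw [map_smul]; exact Submodule.smul_mem _ _ hx

end ModTwoChain

/-! ### Zeros of maps on polyhedra. -/

namespace ModTwoChain
open MvPolynomial Finset Filter Topology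

variable {W : Type*}

lemma degree_expo (s : Finset W) : (expo s).degree = s.card := by
  simp [expo, Finsupp.degree_single]

/-- The geometric simplex spanned by a finite set of vertices, in barycentric coordinates. -/
def face (s : Finset W) : Set (W → ℝ) :=
  {x | (∀ v, 0 ≤ x v) ∧ (∀ v, v ∉ s → x v = 0) ∧ ∑ v ∈ s, x v = 1}

/-- The union of the geometric simplices in a family. -/
def polyhedron (A : Finset (Finset W)) : Set (W → ℝ) := ⋃ t ∈ A, face t

lemma mem_polyhedron {A : Finset (Finset W)} {x : W → ℝ} :
    x ∈ polyhedron A ↔ ∃ t ∈ A, x ∈ face t := by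
  simp [polyhedron]

lemma face_mono {s t : Finset W} (h : s ⊆ t) : face s ⊆ face t := fun x hx =>
  ⟨hx.1, fun v hv => hx.2.1 v fun hv' => hv (h hv'), by
    rw [← hx.2.2]
    exact (sum_subset h fun v _ hv => hx.2.1 v hv).symm⟩

lemma convex_face (s : Finset W) : Convex ℝ (face s) := by
  intro x hx y hy a b ha hb hab
  refine ⟨fun v => ?_, fun v hv => ?_, ?_⟩
  · have := mul_nonneg ha (hx.1 v)
    have := mul_nonneg hb (hy.1 v)
    simp; linarith
  · simp [hx.2.1 v hv, hy.2.1 v hv]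
  · simp [sum_add_distrib, ← mul_sum, hx.2.2, hy.2.2, hab]

lemma single_mem_face [DecidableEq W] {s : Finset W} {w : W} (hw : w ∈ s) :
    Pi.single w (1 : ℝ) ∈ face s := by
  refine ⟨fun v => ?_, fun v hv => ?_, ?_⟩
  · by_cases h : v = w
    · subst h; simp
    · simp [h]
  · have : v ≠ w := fun h => hv (h ▸ hw)
    simp [this]
  · rw [sum_pi_single', if_pos hw]

lemma le_one_of_mem_face {s : Finset W} {x : W → ℝ} (hx : x ∈ face s) (v : W) : x v ≤ 1 := by
  by_cases hv : v ∈ s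
  · rw [← hx.2.2]
    exact single_le_sum (fun i _ => hx.1 i) hv
  · rw [hx.2.1 v hv]; exact zero_le_one

lemma isClosed_face (s : Finset W) : IsClosed (face s) := by
  have h1 : IsClosed {x : W → ℝ | ∀ v, 0 ≤ x v} := by
    simp only [Set.ofPred_forall]
    exact isClosed_iInter fun v => isClosed_le continuous_const (continuous_apply v)
  have h2 : IsClosed {x : W → ℝ | ∀ v, v ∉ s → x v = 0} := by
    simp only [Set.ofPred_forall]
    exact isClosed_iInter fun v => isClosed_iInter fun _ =>
      isClosed_eq (continuous_apply v) continuous_const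
  have h3 : IsClosed {x : W → ℝ | ∑ v ∈ s, x v = 1} :=
    isClosed_eq (by fun_prop) continuous_const
  exact h1.inter (h2.inter h3)

lemma isCompact_face (s : Finset W) : IsCompact (face s) :=
  (isCompact_univ_pi fun _ : W => isCompact_Icc (a := (0 : ℝ)) (b := 1)).of_isClosed_subset
    (isClosed_face s) fun _ hx v _ => ⟨hx.1 v, le_one_of_mem_face hx v⟩

lemma isCompact_polyhedron (A : Finset (Finset W)) : IsCompact (polyhedron A) :=
  A.isCompact_biUnion fun t _ => isCompact_face t

variable [Fintype W] [DecidableEq W]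

/-- Serves two purposes: subdivision points stay in their face, as a Sperner labelling requires, and
the mesh tends to zero. -/
lemma subdiv_pow_face_subset (n : ℕ) (s : Finset W) (hs : s.card ≤ n + 1) (N : ℕ)
    {m : (W → ℝ) →₀ ℕ} (hm : m ∈ ((subdiv barycenter s.card ^ N)
      (∏ w ∈ s, X (Pi.single w (1 : ℝ)))).support) :
    m ∈ fineSimplices (face s) ((n / (n + 1)) ^ N) s.card := by
  have hinj : Function.Injective fun w : W => Pi.single (M := fun _ => ℝ) w (1 : ℝ) := by
    intro v w h
    by_contra hvw
    have := congrFun h v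
    simp [hvw] at this
  have h1 : (∏ w ∈ s, X (Pi.single w (1 : ℝ)) : MvPolynomial (W → ℝ) (ZMod 2)) =
      monomial (expo (s.map ⟨_, hinj⟩)) 1 := by
    rw [← prod_X_eq, prod_map]; rfl
  have hdist : ∀ v w : W, dist (Pi.single v (1 : ℝ) : W → ℝ) (Pi.single w (1 : ℝ)) ≤ 1 := by
    intro v w
    refine (dist_pi_le_iff zero_le_one).2 fun u => ?_
    simp only [Pi.single_apply]
    split_ifs <;> simp
  have h2 : expo (s.map ⟨_, hinj⟩) ∈ fineSimplices (face s) 1 s.card := by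
    refine ⟨by rw [degree_expo, card_map], ?_, ?_⟩
    · rw [support_expo]
      intro x hx
      obtain ⟨w, hw, rfl⟩ := mem_map.1 hx
      exact single_mem_face hw
    · rw [support_expo]
      intro x hx y hy
      obtain ⟨w, hw, rfl⟩ := mem_map.1 hx
      obtain ⟨v, hv, rfl⟩ := mem_map.1 hy
      exact hdist w v
  rw [h1] at hm
  have := (mem_restrictSupport_iff _).1
    (subdiv_pow_mem_restrictSupport (convex_face s) zero_le_one hs h2 N) hm
  rwa [mul_one] at this

/-- A zero exists for a map on a polyhedron whose values on the mod 2 boundary form, by their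
largest coordinates, a Sperner labelling of odd degree. -/
theorem exists_eq_zero_of_sperner {d : ℕ} (φ : W → Fin (d + 1)) (A B : Finset (Finset W))
    (hAB : boundary W (∑ t ∈ A, ∏ w ∈ t, X w) = ∑ s ∈ B, ∏ w ∈ s, X w)
    (hA : ∀ t ∈ A, t.card = d + 1) (hB : ∀ s ∈ B, s.card = d)
    (hodd : Odd ({s ∈ B | s.image φ = univ.erase 0} : Finset (Finset W)).card)
    (h : (W → ℝ) → Fin (d + 1) → ℝ) (hcont : ContinuousOn h (polyhedron A))
    (hsum : ∀ x ∈ polyhedron A, ∑ i, h x i = 0)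
    (hbd : ∀ s ∈ B, ∀ x ∈ face s, ∀ i, (∀ w, x w ≠ 0 → φ w ≠ i) → ∃ j, h x i < h x j) :
    ∃ x ∈ polyhedron A, h x = 0 := by
  -- Each point is labelled by an index of a largest coordinate of `h`; `hbd` makes this a Sperner
  -- labelling on the boundary.
  choose lab hlab using fun x => Finite.exists_max (h x)
  have key : ∀ N : ℕ, ∃ t ∈ A, ∃ x : Fin (d + 1) → W → ℝ, (∀ i, x i ∈ face t) ∧
      (∀ i, lab (x i) = i) ∧ ∀ i j, dist (x i) (x j) ≤ ((d : ℝ) / (d + 1)) ^ N := by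
    intro N
    obtain ⟨t, ht, m, hm, hmx⟩ := exists_fully_labelled barycenter
      (fun w : W => Pi.single (M := fun _ => ℝ) w (1 : ℝ)) φ lab N A B hAB hB hodd (by
        intro s hs s' hs' m hm x hx
        have hc : s'.card ≤ d + 1 := (card_le_card hs').trans (by rw [hB s hs]; omega)
        have hx' := (subdiv_pow_face_subset d s' hc N hm).2.1 hx
        by_contra hcon
        obtain ⟨j, hj⟩ := hbd s hs x (face_mono hs' hx') (lab x) fun w hw hwx =>
          hcon (mem_image.2 ⟨w, by by_contra hw'; exact hw (hx'.2.1 w hw'), hwx⟩)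
        exact absurd (hlab x j) (not_le.2 hj))
    rw [← hA t ht] at hm
    have hm' := subdiv_pow_face_subset d t (hA t ht).le N hm
    choose x hx hxi using hmx
    exact ⟨t, ht, x, fun i => hm'.2.1 (hx i), hxi, fun i j => hm'.2.2 _ (hx i) _ (hx j)⟩
  choose t ht x hxt hxlab hxdist using key
  have hmem : ∀ N i, x N i ∈ polyhedron A := fun N i => mem_polyhedron.2 ⟨t N, ht N, hxt N i⟩
  obtain ⟨a, ha, ψ, hψ, hlim⟩ := (isCompact_polyhedron A).tendsto_subseq fun N => hmem N 0
  have hpow : Tendsto (fun N => ((d : ℝ) / (d + 1)) ^ ψ N) atTop (𝓝 0) :=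
    (tendsto_pow_atTop_nhds_zero_of_lt_one (by positivity)
      ((div_lt_one (by positivity)).2 (by linarith))).comp hψ.tendsto_atTop
  have hlim' : ∀ i, Tendsto (fun N => x (ψ N) i) atTop (𝓝 a) := by
    intro i
    refine hlim.congr_dist (squeeze_zero (fun _ => dist_nonneg) (fun N => ?_) hpow)
    exact hxdist (ψ N) 0 i
  have hh : ∀ i, Tendsto (fun N => h (x (ψ N) i)) atTop (𝓝 (h a)) := fun i =>
    (hcont a ha).tendsto.comp (tendsto_nhdsWithin_iff.2
      ⟨hlim' i, Eventually.of_forall fun N => hmem _ _⟩)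
  -- The vertices of ever smaller fully labelled simplices all tend to `a`, so each coordinate of `h
  -- a` is maximal. All coordinates are then equal, and they sum to zero.
  have hle : ∀ i j, h a j ≤ h a i := by
    intro i j
    refine le_of_tendsto_of_tendsto' (tendsto_pi_nhds.1 (hh i) j) (tendsto_pi_nhds.1 (hh i) i)
      fun N => ?_
    have := hlab (x (ψ N) i) j
    rwa [hxlab] at this
  refine ⟨a, ha, funext fun i => ?_⟩
  have h1 : ∑ j, h a j = ∑ _j : Fin (d + 1), h a i :=
    sum_congr rfl fun j _ => le_antisymm (hle i j) (hle j i)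
  rw [hsum a ha, sum_const, card_univ, Fintype.card_fin, nsmul_eq_mul] at h1
  have h2 : ((d + 1 : ℕ) : ℝ) ≠ 0 := by positivity
  exact (mul_eq_zero.1 h1.symm).resolve_left h2

end ModTwoChain

/-! ### Injective maps and stable zeros. -/

section InvarianceOfDomain

open Filter Topology Metric Set MeasureTheory

/-- Let `p` vanish at `x₀` only, stably in the sense that every map close to `p` has a zero. Then
every continuous injective map to `ℝᵈ` is a neighborhood of its value at `x₀`. -/
theorem range_mem_nhds_of_stable_zero {X : Type*} [TopologicalSpace X] [CompactSpace X] {d : ℕ}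
    {x₀ : X} {p : X → Fin d → ℝ} (hp : Continuous p) (hp0 : ∀ x, p x = 0 ↔ x = x₀) {δ : ℝ}
    (hδ : 0 < δ)
    (hstab : ∀ h : X → Fin d → ℝ, Continuous h → (∀ x, ‖h x - p x‖ ≤ δ) → ∃ x, h x = 0)
    {f : X → Fin d → ℝ} (hf : Continuous f) (hinj : Function.Injective f) :
    range f ∈ 𝓝 (f x₀) := by
  by_contra hcon
  have hemb : IsClosedEmbedding f := hf.isClosedEmbedding hinj
  -- By Tietze, `p ∘ f⁻¹` extends from the compact image of `f` to all of `ℝᵈ`.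
  obtain ⟨G, hG⟩ := ContinuousMap.exists_extension hemb ⟨p, hp⟩
  have hGf : ∀ x, G (f x) = p x := fun x => DFunLike.congr_fun hG x
  have hG0 : G (f x₀) = 0 := by rw [hGf, hp0]
  obtain ⟨ε, hε, hGε⟩ : ∃ ε > 0, ∀ y, dist y (f x₀) < ε → ‖G y‖ < δ / 3 := by
    obtain ⟨ε, hε, h⟩ := Metric.continuous_iff.1 G.continuous (f x₀) (δ / 3) (by positivity)
    exact ⟨ε, hε, fun y hy => by simpa [hG0] using h y hy⟩
  obtain ⟨c, hc, hcf⟩ : ∃ c, dist c (f x₀) < ε / 3 ∧ c ∉ range f := by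
    by_contra! h
    exact hcon (mem_of_superset (ball_mem_nhds _ (by positivity)) h)
  set r := ε / 3 with hr
  have hr0 : 0 < r := by positivity
  have hGc : ∀ y, dist y c ≤ r → ‖G y‖ < δ / 3 := fun y hy =>
    hGε y (by linarith [dist_triangle y c (f x₀)])
  set S := range f \ ball c r with hS
  have hScomp : IsCompact S := (isCompact_range hf).diff isOpen_ball
  have hSG : ∀ y ∈ S, 0 < ‖G y‖ := by
    rintro _ ⟨⟨x, rfl⟩, hx⟩
    rw [norm_pos_iff, hGf, Ne, hp0]
    rintro rfl
    exact hx (by rw [mem_ball, dist_comm]; exact hc)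
  obtain ⟨η, hη, hηδ, hηG⟩ : ∃ η > 0, η ≤ δ / 3 ∧ ∀ y ∈ S, η ≤ ‖G y‖ := by
    obtain ⟨η, hη, h⟩ := hScomp.exists_forall_le' G.continuous.norm.continuousOn hSG
    exact ⟨min η (δ / 3), lt_min hη (by positivity), min_le_right _ _,
      fun y hy => (min_le_left _ _).trans (h y hy)⟩
  -- A differentiable approximation maps the sphere to a null set, so a small translation `v` makes
  -- `P - v` nonzero there. Off the ball it stays nonzero on the image of `f`, because the total
  -- error is below `η ≤ ‖G y‖`.
  obtain ⟨P, hP, hPG, -⟩ := G.continuous.exists_contDiff_approx (E := Fin d → ℝ) 1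
    (continuous_const : Continuous fun _ => η / 2) (fun _ => by positivity)
  have hnull : volume (P '' sphere c r) = 0 :=
    addHaar_image_eq_zero_of_differentiableOn_of_addHaar_eq_zero volume
      (hP.differentiable (by simp)).differentiableOn
      (Measure.addHaar_sphere_of_ne_zero volume c hr0.ne')
  obtain ⟨v, hv, hvP⟩ : ∃ v : Fin d → ℝ, ‖v‖ < η / 2 ∧ v ∉ P '' sphere c r := by
    by_contra! h
    have h1 : ball (0 : Fin d → ℝ) (η / 2) ⊆ P '' sphere c r := fun v hv =>
      h v (by simpa using hv)
    exact (measure_ball_pos volume (0 : Fin d → ℝ) (by positivity : 0 < η / 2)).ne'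
      (measure_mono_null h1 hnull)
  have happrox : ∀ y, ‖P y - v - G y‖ < η := by
    intro y
    have h1 := hPG y
    rw [dist_eq_norm] at h1
    calc ‖P y - v - G y‖ = ‖(P y - G y) - v‖ := by congr 1; abel
      _ ≤ ‖P y - G y‖ + ‖v‖ := norm_sub_le _ _
      _ < η := by linarith
  have hfc : ∀ x, dist (f x) c ≠ 0 := fun x h => hcf ⟨x, dist_eq_zero.1 h⟩
  -- Since `c` is not a value of `f`, the part of the image within distance `r` of `c` can be pushed
  -- radially onto the sphere. The map `P ∘ Φ - v` is then `δ`-close to `p` but has no zero.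
  set Φ : X → Fin d → ℝ := fun x => c + max (r / dist (f x) c) 1 • (f x - c) with hΦ
  have hΦc : Continuous Φ := by
    have : Continuous fun x => r / dist (f x) c :=
      continuous_const.div (hf.dist continuous_const) hfc
    exact continuous_const.add ((this.max continuous_const).smul (hf.sub continuous_const))
  have hfar : ∀ x, r ≤ dist (f x) c → Φ x = f x := by
    intro x hx
    have : r / dist (f x) c ≤ 1 := (div_le_one (hr0.trans_le hx)).2 hx
    simp [hΦ, max_eq_right this]
  have hnear : ∀ x, dist (f x) c ≤ r → Φ x ∈ sphere c r := by
    intro x hx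
    have h0 : 0 < dist (f x) c := lt_of_le_of_ne dist_nonneg (hfc x).symm
    have : 1 ≤ r / dist (f x) c := (one_le_div h0).2 hx
    rw [mem_sphere, hΦ, dist_eq_norm]
    simp only [max_eq_left this, add_sub_cancel_left]
    rw [norm_smul, Real.norm_of_nonneg (by positivity), ← dist_eq_norm, div_mul_cancel₀ _ h0.ne']
  obtain ⟨x, hx⟩ := hstab (fun x => P (Φ x) - v) ((hP.continuous.comp hΦc).sub continuous_const)
    (by
      intro x
      rcases le_total r (dist (f x) c) with h | h
      · rw [hfar x h, ← hGf]
        linarith [happrox (f x)]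
      · have h1 := hGc _ (mem_sphere.1 (hnear x h)).le
        have h2 := hGc _ h
        have h3 := happrox (Φ x)
        rw [← hGf]
        calc ‖P (Φ x) - v - G (f x)‖ = ‖(P (Φ x) - v - G (Φ x)) + (G (Φ x) - G (f x))‖ := by
              congr 1; abel
          _ ≤ ‖P (Φ x) - v - G (Φ x)‖ + (‖G (Φ x)‖ + ‖G (f x)‖) :=
              (norm_add_le _ _).trans (add_le_add_right (norm_sub_le _ _) _)
          _ ≤ δ := by linarith)
  have hx' : P (Φ x) = v := sub_eq_zero.1 hx
  rcases le_total r (dist (f x) c) with h | h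
  · have h1 := happrox (f x)
    rw [hfar x h] at hx'
    rw [hx', sub_self, zero_sub, norm_neg] at h1
    exact absurd (hηG (f x) ⟨mem_range_self x, by simpa using h⟩) (not_le.2 h1)
  · exact hvP ⟨Φ x, hnear x h, hx'⟩

end InvarianceOfDomain

/-! ### Invariance of domain, and cones over mod 2 cycles. -/

namespace ModTwoChain
open MvPolynomial Finset Filter Topology

variable {W : Type*} [Fintype W]

lemma sum_univ_of_mem_face {s : Finset W} {x : W → ℝ} (hx : x ∈ face s) : ∑ v, x v = 1 := by
  rw [← hx.2.2]
  exact (sum_subset (subset_univ s) fun v _ hv => hx.2.1 v hv).symm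

variable [DecidableEq W]

/-- Invariance of domain for a polyhedron with a map `p` to the hyperplane `∑ i, y i = 0` that has
odd degree at its only zero. -/
theorem image_polyhedron_mem_nhds {d : ℕ} (φ : W → Fin (d + 1)) (A B : Finset (Finset W))
    (hAB : boundary W (∑ t ∈ A, ∏ w ∈ t, X w) = ∑ s ∈ B, ∏ w ∈ s, X w)
    (hA : ∀ t ∈ A, t.card = d + 1) (hB : ∀ s ∈ B, s.card = d) (hBA : ∀ s ∈ B, ∃ t ∈ A, s ⊆ t)
    (hodd : Odd ({s ∈ B | s.image φ = univ.erase 0} : Finset (Finset W)).card)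
    {p : (W → ℝ) → Fin (d + 1) → ℝ} (hp : Continuous p)
    (hsum : ∀ x ∈ polyhedron A, ∑ i, p x i = 0)
    (hbd : ∀ s ∈ B, ∀ x ∈ face s, ∀ i, (∀ w, x w ≠ 0 → φ w ≠ i) → p x i ≤ -(1 / (d + 1)))
    {x₀ : W → ℝ} (hx₀ : x₀ ∈ polyhedron A) (hp0 : ∀ x ∈ polyhedron A, p x = 0 ↔ x = x₀)
    {f : (W → ℝ) → Fin d → ℝ} (hf : ContinuousOn f (polyhedron A))
    (hinj : Set.InjOn f (polyhedron A)) : f '' polyhedron A ∈ 𝓝 (f x₀) := by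
  classical
  have : CompactSpace (polyhedron A) := isCompact_iff_compactSpace.1 (isCompact_polyhedron A)
  have hd0 : (0 : ℝ) < d + 1 := by positivity
  have hzero : ∀ x ∈ polyhedron A, p x 0 = -∑ i : Fin d, p x i.succ := by
    intro x hx
    have := hsum x hx
    rw [Fin.sum_univ_succ] at this
    linarith
  have := range_mem_nhds_of_stable_zero (X := polyhedron A) (x₀ := ⟨x₀, hx₀⟩)
    (p := fun x i => p x i.succ) (by fun_prop)
    (by
      intro x
      rw [Subtype.ext_iff, ← hp0 x x.2]
      refine ⟨fun h => ?_, fun h => by simp only [h]; rfl⟩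
      have h' : ∀ i : Fin d, p x i.succ = 0 := fun i => congrFun h i
      funext i
      refine Fin.cases ?_ (fun i => h' i) i
      rw [hzero x x.2]
      simp [h'])
    -- Coordinate `0` is dropped and later restored as minus the sum of the others, so its error is
    -- up to `d * δ`. This choice keeps every error at most a quarter of the gap `1 / (d + 1)` from
    -- `hbd`.
    (δ := 1 / (4 * (d + 1) ^ 2)) (by positivity)
    (by
      intro h hh hclose
      set H : (W → ℝ) → Fin (d + 1) → ℝ := fun x => if hx : x ∈ polyhedron A then
        Fin.cons (-∑ i, h ⟨x, hx⟩ i) (h ⟨x, hx⟩) else 0 with hH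
      have hH0 : ∀ x (hx : x ∈ polyhedron A), H x 0 = -∑ i, h ⟨x, hx⟩ i := by
        intro x hx; simp [hH, hx]
      have hHs : ∀ x (hx : x ∈ polyhedron A) (i : Fin d), H x i.succ = h ⟨x, hx⟩ i := by
        intro x hx i; simp [hH, hx]
      have hdist : ∀ x (hx : x ∈ polyhedron A) (i : Fin d),
          |h ⟨x, hx⟩ i - p x i.succ| ≤ 1 / (4 * (d + 1) ^ 2) := fun x hx i =>
        (norm_le_pi_norm (h ⟨x, hx⟩ - fun i => p x i.succ) i).trans (hclose ⟨x, hx⟩)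
      have hδ : (d : ℝ) * (1 / (4 * (d + 1) ^ 2)) ≤ 1 / (4 * (d + 1)) := by
        rw [mul_one_div, div_le_div_iff₀ (by positivity) (by positivity)]
        nlinarith
      have hδ' : 1 / (4 * ((d : ℝ) + 1) ^ 2) ≤ 1 / (4 * (d + 1)) := by
        refine one_div_le_one_div_of_le (by positivity) ?_
        have : (0 : ℝ) ≤ d := by positivity
        nlinarith
      have hHp : ∀ x ∈ polyhedron A, ∀ i, |H x i - p x i| ≤ 1 / (4 * (d + 1)) := by
        intro x hx i
        refine Fin.cases ?_ (fun i => ?_) i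
        · rw [hH0 x hx, hzero x hx, neg_sub_neg, abs_sub_comm, ← sum_sub_distrib]
          calc _ ≤ ∑ i, |h ⟨x, hx⟩ i - p x i.succ| := abs_sum_le_sum_abs _ _
            _ ≤ ∑ _i : Fin d, 1 / (4 * ((d : ℝ) + 1) ^ 2) := sum_le_sum fun i _ => hdist x hx i
            _ = d * (1 / (4 * ((d : ℝ) + 1) ^ 2)) := by simp
            _ ≤ _ := hδ
        · rw [hHs x hx]
          exact (hdist x hx i).trans hδ'
      obtain ⟨x, hx, hx0⟩ := exists_eq_zero_of_sperner φ A B hAB hA hB hodd H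
        (by
          rw [continuousOn_iff_continuous_domRestrict]
          refine continuous_pi fun i => ?_
          refine Fin.cases ?_ (fun i => ?_) i
          · have : (fun x : polyhedron A => H x 0) = fun x => -∑ i, h x i :=
              funext fun x => hH0 x x.2
            change Continuous fun x : polyhedron A => H x 0
            rw [this]
            fun_prop
          · have : (fun x : polyhedron A => H x i.succ) = fun x => h x i :=
              funext fun x => hHs x x.2 i
            change Continuous fun x : polyhedron A => H x i.succ
            rw [this]
            fun_prop)
        (by
          intro x hx
          rw [Fin.sum_univ_succ, hH0 x hx]
          simp [hHs x hx])
        (by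
          intro s hs x hx i hi
          have hpi := hbd s hs x hx i hi
          obtain ⟨t, ht, hst⟩ := hBA s hs
          have hxA : x ∈ polyhedron A := mem_polyhedron.2 ⟨t, ht, face_mono hst hx⟩
          obtain ⟨j, hj⟩ : ∃ j, 0 ≤ p x j := by
            by_contra! hneg
            exact (sum_neg (fun j _ => hneg j) univ_nonempty).ne (hsum x hxA)
          refine ⟨j, ?_⟩
          have h1 := abs_le.1 (hHp x hxA i)
          have h2 := abs_le.1 (hHp x hxA j)
          have h3 : 1 / (4 * ((d : ℝ) + 1)) = 1 / (d + 1) / 4 := by field_simp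
          have h4 : 0 < 1 / ((d : ℝ) + 1) := by positivity
          rw [h3] at h1 h2
          linarith [h1.2, h2.1])
      refine ⟨⟨x, hx⟩, funext fun i => ?_⟩
      rw [← hHs x hx, hx0]; rfl)
    (f := fun x => f x) hf.domRestrict (fun x y hxy => Subtype.ext (hinj x.2 y.2 hxy))
  convert this using 1
  ext y; simp

/-- With the identity labelling, exactly one facet carries all nonzero labels, so the degree is odd.
The recentred coordinates `x i - 1 / (d + 1)` vanish only at the centroid and equal `-(1 / (d + 1))`
where `x i = 0`. -/
theorem image_simplex_mem_nhds {d : ℕ} {f : (Fin (d + 1) → ℝ) → Fin d → ℝ}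
    (hf : ContinuousOn f (face univ)) (hinj : Set.InjOn f (face univ)) :
    f '' face univ ∈ 𝓝 (f fun _ => 1 / (d + 1)) := by
  have hpoly : polyhedron {(univ : Finset (Fin (d + 1)))} = face univ := by simp [polyhedron]
  have hsum : ∀ x ∈ polyhedron {(univ : Finset (Fin (d + 1)))}, ∑ i, x i = 1 := by
    rw [hpoly]; exact fun x hx => sum_univ_of_mem_face hx
  have hd0 : (0 : ℝ) < d + 1 := by positivity
  have hinj' : Function.Injective fun i : Fin (d + 1) => univ.erase i := fun i j h =>
    (erase_inj _ (mem_univ i)).1 h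
  rw [← hpoly] at hf hinj ⊢
  refine image_polyhedron_mem_nhds id {univ} (univ.image fun i => univ.erase i)
    ?_ ?_ ?_ ?_ ?_ (p := fun x i => x i - 1 / (d + 1)) (by fun_prop) ?_ ?_ ?_ ?_ hf hinj
  · rw [sum_singleton, boundary_prod, sum_image hinj'.injOn]
  · simp
  · simp
  · simp
  · have : ({s ∈ univ.image fun i : Fin (d + 1) => univ.erase i |
        s.image id = univ.erase 0} : Finset _) = {univ.erase 0} := by
      ext s
      simp only [image_id, mem_filter, mem_singleton, mem_image, mem_univ, true_and]
      exact ⟨fun h => h.2, fun h => ⟨⟨0, h.symm⟩, h⟩⟩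
    rw [this]
    simp
  · intro x hx
    rw [sum_sub_distrib, hsum x hx]
    simp; field_simp; simp
  · intro s _ x _ i hi
    have : x i = 0 := by
      by_contra h
      exact hi i h rfl
    simp [this]
  · rw [hpoly]
    refine ⟨fun _ => by positivity, by simp, ?_⟩
    simp; field_simp
  · intro x _
    simp only [funext_iff, Pi.zero_apply, sub_eq_zero]

/-- **Invariance of domain**. -/
theorem image_mem_nhds_of_injOn {d : ℕ} {U : Set (Fin d → ℝ)} {x₀ : Fin d → ℝ} (hU : U ∈ 𝓝 x₀)
    {g : (Fin d → ℝ) → Fin d → ℝ} (hg : ContinuousOn g U) (hinj : Set.InjOn g U) :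
    g '' U ∈ 𝓝 (g x₀) := by
  obtain ⟨ε, hε, hεU⟩ := Metric.nhds_basis_closedBall.mem_iff.1 hU
  -- An affine embedding of the standard simplex into the `ε`-ball that takes the centroid to `x₀`.
  set a : (Fin (d + 1) → ℝ) → Fin d → ℝ := fun x => x₀ + ε • fun i => x i.succ - 1 / (d + 1)
    with ha
  have hd0 : (0 : ℝ) < d + 1 := by positivity
  have haU : Set.MapsTo a (face univ) U := by
    intro x hx
    apply hεU
    rw [mem_closedBall_iff_norm, ha]
    simp only [add_sub_cancel_left]
    rw [norm_smul, Real.norm_of_nonneg hε.le]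
    refine mul_le_of_le_one_right hε.le ((pi_norm_le_iff_of_nonneg zero_le_one).2 fun i => ?_)
    have h1 := hx.1 i.succ
    have h2 := le_one_of_mem_face hx i.succ
    have h3 : 0 < 1 / ((d : ℝ) + 1) := by positivity
    have h4 : 1 / ((d : ℝ) + 1) ≤ 1 := by
      rw [div_le_one hd0]; linarith [(Nat.cast_nonneg d : (0 : ℝ) ≤ d)]
    rw [Real.norm_eq_abs, abs_le]
    constructor <;> linarith
  have hac : Continuous a := by fun_prop
  have hainj : Set.InjOn a (face univ) := by
    intro x hx y hy hxy
    have h1 : ∀ i : Fin d, x i.succ = y i.succ := by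
      intro i
      have := congrFun hxy i
      simpa [ha, hε.ne'] using this
    have h2 := sum_univ_of_mem_face hx
    have h3 := sum_univ_of_mem_face hy
    rw [Fin.sum_univ_succ] at h2 h3
    simp only [h1] at h2
    funext i
    exact Fin.cases (by linarith) h1 i
  have h := image_simplex_mem_nhds (hg.comp hac.continuousOn haU) (hinj.comp hainj haU)
  have hx₀ : a (fun _ => 1 / (d + 1)) = x₀ := by
    ext i; simp [ha]
  rw [Function.comp_apply, hx₀] at h
  refine mem_of_superset h ?_
  rintro _ ⟨x, hx, rfl⟩
  exact ⟨a x, haU hx, rfl⟩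

/-- Facets containing `p` occur an even number of times and cancel; only the facets opposite `p`
remain, each occurring once. -/
lemma boundary_of_even {d : ℕ} (A : Finset (Finset W)) (p : W) (hA : ∀ t ∈ A, t.card = d + 1)
    (hp : ∀ t ∈ A, p ∈ t)
    (heven : ∀ s : Finset W, p ∈ s → s.card = d → Even ({t ∈ A | s ⊆ t} : Finset _).card) :
    boundary W (∑ t ∈ A, ∏ w ∈ t, X w) = ∑ s ∈ A.image fun t => t.erase p, ∏ w ∈ s, X w := by
  have hinj : Set.InjOn (fun t : Finset W => t.erase p) A := by
    intro s hs t ht hst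
    rw [← insert_erase (hp s hs), ← insert_erase (hp t ht)]
    exact congrArg (insert p) hst
  rw [sum_image hinj, map_sum]
  have h1 : ∀ t ∈ A, boundary W (∏ w ∈ t, X w) = ∏ w ∈ t.erase p, X w +
      ∑ s : Finset W with p ∈ s ∧ s.card = d,
        if s ⊆ t then (∏ w ∈ s, X w : MvPolynomial W (ZMod 2)) else 0 := by
    intro t ht
    rw [boundary_prod, ← add_sum_erase t _ (hp t ht), ← sum_filter, filter_filter]
    congr 1
    refine sum_nbij (fun v => t.erase v) ?_ ?_ ?_ (fun _ _ => rfl)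
    · intro v hv
      obtain ⟨hvp, hv⟩ := mem_erase.1 hv
      simp only [mem_filter, mem_univ, true_and]
      exact ⟨⟨mem_erase.2 ⟨hvp.symm, hp t ht⟩, by rw [card_erase_of_mem hv, hA t ht]; rfl⟩,
        erase_subset _ _⟩
    · intro v hv w hw hvw
      exact (erase_inj t (mem_of_mem_erase hv)).1 hvw
    · intro s hs
      obtain ⟨⟨hps, hsc⟩, hst⟩ : (p ∈ s ∧ s.card = d) ∧ s ⊆ t := by simpa using hs
      have : (t \ s).card = 1 := by rw [card_sdiff_of_subset hst, hA t ht, hsc]; omega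
      obtain ⟨v, hv⟩ := card_eq_one.1 this
      have hv' : v ∈ t ∧ v ∉ s := mem_sdiff.1 (hv ▸ mem_singleton_self v)
      refine ⟨v, ?_, ?_⟩
      · exact mem_erase.2 ⟨fun h => hv'.2 (h ▸ hps), hv'.1⟩
      · change t.erase v = s
        rw [← sdiff_singleton_eq_erase, ← hv, Finset.sdiff_sdiff_eq_self hst]
  rw [sum_congr rfl h1, sum_add_distrib, add_eq_left, sum_comm]
  refine sum_eq_zero fun s hs => ?_
  obtain ⟨hps, hsc⟩ : p ∈ s ∧ s.card = d := by simpa using hs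
  obtain ⟨k, hk⟩ := heven s hps hsc
  rw [← sum_filter, sum_const, hk, add_smul, CharTwo.add_self_eq_zero]

/-- A cone with apex `p` over a mod 2 cycle of dimension `d - 1` that is embedded in `ℝᵈ` is a
neighborhood of its apex. -/
theorem image_cone_mem_nhds {d : ℕ} (A : Finset (Finset W)) (hne : A.Nonempty) (p : W)
    (hA : ∀ t ∈ A, t.card = d + 1) (hp : ∀ t ∈ A, p ∈ t)
    (heven : ∀ s : Finset W, p ∈ s → s.card = d → Even ({t ∈ A | s ⊆ t} : Finset _).card)
    {f : (W → ℝ) → Fin d → ℝ} (hf : ContinuousOn f (polyhedron A))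
    (hinj : Set.InjOn f (polyhedron A)) : f '' polyhedron A ∈ 𝓝 (f (Pi.single p 1)) := by
  obtain ⟨t₀, ht₀⟩ := hne
  have hcard : ∀ t ∈ A, (t.erase p).card = d := fun t ht => by
    rw [card_erase_of_mem (hp t ht), hA t ht]; rfl
  have hd0 : (0 : ℝ) < d + 1 := by positivity
  -- The base of `t₀` receives the labels `1, …, d` bijectively and every other vertex the label
  -- `0`, so the base of `t₀` is the only one with all nonzero labels and the degree is odd.
  obtain ⟨φ, hφ, hφ0⟩ : ∃ φ : W → Fin (d + 1), (t₀.erase p).image φ = univ.erase 0 ∧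
      ∀ w, w ∉ t₀.erase p → φ w = 0 := by
    set e := equivFinOfCardEq (hcard t₀ ht₀)
    refine ⟨fun w => if h : w ∈ t₀.erase p then (e ⟨w, h⟩).succ else 0, ?_, fun w hw => ?_⟩
    · ext i
      refine Fin.cases ?_ (fun i => ?_) i
      · simp only [mem_image, mem_erase, ne_eq, not_true_eq_false, false_and, iff_false, not_exists]
        rintro w ⟨hw, h⟩
        rw [dif_pos hw] at h
        exact Fin.succ_ne_zero _ h
      · simp only [mem_image, mem_erase, ne_eq, Fin.succ_ne_zero, not_false_eq_true, mem_univ,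
          and_self, iff_true]
        refine ⟨e.symm i, mem_erase.1 (e.symm i).2, ?_⟩
        rw [dif_pos (mem_erase.1 (e.symm i).2)]
        simp
    · exact dif_neg hw
  have hsplit : ∀ x : W → ℝ, ∑ i, ∑ w ∈ univ.erase p with φ w = i, x w = ∑ w, x w - x p := by
    intro x
    rw [sum_fiberwise, ← add_sum_erase univ x (mem_univ p), add_sub_cancel_left]
  have hsum : ∀ x ∈ polyhedron A, ∑ i, x i = 1 := by
    intro x hx
    obtain ⟨t, -, hxt⟩ := mem_polyhedron.1 hx
    exact sum_univ_of_mem_face hxt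
  refine image_polyhedron_mem_nhds φ A (A.image fun t => t.erase p)
    (boundary_of_even A p hA hp heven) hA ?_ ?_ ?_
    -- The weight off the apex is collected by label and recentred by its mean over the `d + 1`
    -- labels.
    (p := fun x i => ∑ w ∈ univ.erase p with φ w = i, x w - (1 - x p) / (d + 1))
    (by fun_prop) ?_ ?_ ?_ ?_ hf hinj
  · intro s hs
    obtain ⟨t, ht, rfl⟩ := mem_image.1 hs
    exact hcard t ht
  · intro s hs
    obtain ⟨t, ht, rfl⟩ := mem_image.1 hs
    exact ⟨t, ht, erase_subset _ _⟩
  · have : ({s ∈ A.image fun t => t.erase p | s.image φ = univ.erase 0} : Finset _) =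
        {t₀.erase p} := by
      ext s
      simp only [mem_filter, mem_singleton]
      refine ⟨fun ⟨hs, h⟩ => ?_, fun h => ?_⟩
      · obtain ⟨t, ht, rfl⟩ := mem_image.1 hs
        refine eq_of_subset_of_card_le (fun w hw => ?_) (by rw [hcard t ht, hcard t₀ ht₀])
        by_contra hw'
        have h1 : φ w ∈ univ.erase 0 := h ▸ mem_image_of_mem φ hw
        exact (mem_erase.1 h1).1 (hφ0 w hw')
      · subst h
        exact ⟨mem_image_of_mem _ ht₀, hφ⟩
    rw [this]
    simp
  · intro x hx
    rw [sum_sub_distrib, hsplit, hsum x hx]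
    simp; field_simp; simp
  · intro s hs x hx i hi
    obtain ⟨t, ht, rfl⟩ := mem_image.1 hs
    have hxp : x p = 0 := hx.2.1 p (by simp)
    have : ∑ w ∈ univ.erase p with φ w = i, x w = 0 := by
      refine sum_eq_zero fun w hw => ?_
      by_contra h
      exact hi w h (mem_filter.1 hw).2
    simp [this, hxp]
  · exact mem_polyhedron.2 ⟨t₀, ht₀, single_mem_face (hp t₀ ht₀)⟩
  · intro x hx
    constructor
    · intro h
      have h' : ∀ i, ∑ w ∈ univ.erase p with φ w = i, x w = (1 - x p) / (d + 1) := fun i =>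
        sub_eq_zero.1 (congrFun h i)
      obtain ⟨t, ht, hxt⟩ := mem_polyhedron.1 hx
      -- The `d` base vertices miss one of the `d + 1` labels. At a zero this makes the common
      -- weight `(1 - x p) / (d + 1)` vanish, so the point is the apex.
      obtain ⟨i, hi⟩ : ∃ i, i ∉ (t.erase p).image φ := by
        by_contra! hall
        have h1 := card_le_card (fun i _ => hall i : (univ : Finset (Fin (d + 1))) ⊆ _)
        have h2 := card_image_le (s := t.erase p) (f := φ)
        rw [hcard t ht] at h2
        rw [card_univ, Fintype.card_fin] at h1
        omega
      have h0 : ∑ w ∈ univ.erase p with φ w = i, x w = 0 := by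
        refine sum_eq_zero fun w hw => ?_
        obtain ⟨hw1, hw2⟩ := mem_filter.1 hw
        refine hxt.2.1 w fun hwt => hi (mem_image.2 ⟨w, ?_, hw2⟩)
        exact mem_erase.2 ⟨(mem_erase.1 hw1).1, hwt⟩
      have hxp : x p = 1 := by
        have := h' i
        rw [h0, eq_comm, div_eq_zero_iff] at this
        rcases this with h | h
        · linarith
        · exact absurd h hd0.ne'
      have hrest : ∑ w ∈ univ.erase p, x w = 0 := by
        have := add_sum_erase univ x (mem_univ p)
        rw [hsum x hx, hxp] at this
        linarith
      funext w
      by_cases hw : w = p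
      · subst hw; simp [hxp]
      · rw [Pi.single_eq_of_ne hw]
        exact (sum_eq_zero_iff_of_nonneg fun v _ => hxt.1 v).1 hrest w (by simp [hw])
    · rintro rfl
      funext i
      have : ∑ w ∈ univ.erase p with φ w = i, (Pi.single p 1 : W → ℝ) w = 0 := by
        refine sum_eq_zero fun w hw => ?_
        rw [Pi.single_eq_of_ne (mem_erase.1 (mem_filter.1 hw).1).1]
      rw [this]
      simp

end ModTwoChain

/-! ### Transfer to manifolds through charts. -/

section Manifolds

open Filter Topology Set ModTwoChain

section Charts

variable {X : Type*} [TopologicalSpace X] {d : ℕ} {C : Set X}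

/-- Charts of the subtype are rewritten as partial equivalences on the ambient space, so that maps
need not be bundled with membership in `C`. -/
lemma exists_local_chart [ChartedSpace (EuclideanSpace ℝ (Fin d)) C] {x₀ : X} (hx₀ : x₀ ∈ C) :
    ∃ (e : PartialEquiv X (Fin d → ℝ)) (O : Set X), IsOpen O ∧ x₀ ∈ O ∧ e.source = C ∩ O ∧
      IsOpen e.target ∧ ContinuousOn e e.source ∧ ContinuousOn e.symm e.target := by
  classical
  set φ := chartAt (EuclideanSpace ℝ (Fin d)) (⟨x₀, hx₀⟩ : C)
  obtain ⟨O, hO, hOφ⟩ := isOpen_induced_iff.1 φ.open_source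
  have hmem : ∀ x (hx : x ∈ C), (⟨x, hx⟩ : C) ∈ φ.source ↔ x ∈ O := by
    intro x hx; rw [← hOφ]; rfl
  let L := EuclideanSpace.equiv (Fin d) ℝ
  let e : PartialEquiv X (Fin d → ℝ) :=
    { toFun := fun x => if h : x ∈ C then L (φ ⟨x, h⟩) else 0
      invFun := fun y => (φ.symm (L.symm y) : C)
      source := C ∩ O
      target := L.symm ⁻¹' φ.target
      map_source' := by
        rintro x ⟨hx, hxO⟩
        simp only [dif_pos hx, mem_preimage, ContinuousLinearEquiv.symm_apply_apply]
        exact φ.map_source ((hmem x hx).2 hxO)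
      map_target' := by
        intro y hy
        refine ⟨(φ.symm (L.symm y)).2, (hmem _ (φ.symm (L.symm y)).2).1 ?_⟩
        exact φ.map_target hy
      left_inv' := by
        rintro x ⟨hx, hxO⟩
        simp only [dif_pos hx, ContinuousLinearEquiv.symm_apply_apply]
        rw [φ.left_inv ((hmem x hx).2 hxO)]
      right_inv' := by
        intro y hy
        have h := (φ.symm (L.symm y)).2
        simp only [dif_pos h, Subtype.coe_eta]
        rw [φ.right_inv hy, ContinuousLinearEquiv.apply_symm_apply] }
  refine ⟨e, O, hO, (hmem x₀ hx₀).1 (mem_chart_source _ _), rfl,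
    φ.open_target.preimage L.symm.continuous, ?_, ?_⟩
  · have h1 : ContinuousOn (fun x : C => L (φ x)) φ.source :=
      L.continuous.comp_continuousOn φ.continuousOn
    rintro x ⟨hx, hxO⟩
    have h2 : ContinuousAt (fun x : C => e x) ⟨x, hx⟩ := by
      have : (fun x : C => e x) = fun x : C => L (φ x) := funext fun x => dif_pos x.2
      rw [this]
      exact h1.continuousAt (φ.open_source.mem_nhds ((hmem x hx).2 hxO))
    have h3 : ContinuousWithinAt e C x := continuousWithinAt_iff_continuousAt_domRestrict e hx |>.2 h2
    exact h3.mono inter_subset_left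
  · exact continuous_subtype_val.comp_continuousOn
      (φ.continuousOn_symm.comp L.symm.continuous.continuousOn fun _ h => h)

lemma mem_nhdsWithin_of_image_mem_nhds {e : PartialEquiv X (Fin d → ℝ)} {O : Set X}
    (hO : IsOpen O) (he : e.source = C ∩ O) (hec : ContinuousOn e e.source) {M : Set X} {x₀ : X}
    (hx₀ : x₀ ∈ e.source) (hM : M ⊆ e.source) (h : e '' M ∈ 𝓝 (e x₀)) : M ∈ 𝓝[C] x₀ := by
  have h1 : e ⁻¹' (e '' M) ∈ 𝓝[e.source] x₀ := hec x₀ hx₀ h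
  have h2 : 𝓝[e.source] x₀ = 𝓝[C] x₀ := by
    rw [he] at hx₀ ⊢
    exact nhdsWithin_inter_of_mem' (mem_nhdsWithin_of_mem_nhds (hO.mem_nhds hx₀.2))
  have h3 : e.source ∈ 𝓝[C] x₀ := h2 ▸ self_mem_nhdsWithin
  rw [h2] at h1
  filter_upwards [h1, h3] with x ⟨y, hy, hyx⟩ hx
  rwa [← e.injOn (hM hy) hx hyx]

/-- Invariance of domain for maps from `ℝᵈ` to a `d`-manifold. -/
theorem image_mem_nhdsWithin_of_injOn [ChartedSpace (EuclideanSpace ℝ (Fin d)) C]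
    {U : Set (Fin d → ℝ)} {u₀ : Fin d → ℝ} (hU : U ∈ 𝓝 u₀) {h : (Fin d → ℝ) → X}
    (hc : ContinuousOn h U) (hinj : InjOn h U) (hmaps : MapsTo h U C) : h '' U ∈ 𝓝[C] h u₀ := by
  have hu₀ := hmaps (mem_of_mem_nhds hU)
  obtain ⟨e, O, hO, hxO, he, -, hec, -⟩ := exists_local_chart (d := d) hu₀
  set U' := U ∩ h ⁻¹' O
  have hU' : U' ∈ 𝓝 u₀ := inter_mem hU (hc.continuousAt hU (hO.mem_nhds hxO))
  have hmaps' : MapsTo h U' e.source := fun u hu => he ▸ ⟨hmaps hu.1, hu.2⟩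
  have h1 := image_mem_nhds_of_injOn hU' (hec.comp (hc.mono inter_subset_left) hmaps')
    (e.injOn.comp (hinj.mono inter_subset_left) hmaps')
  rw [image_comp] at h1
  refine mem_of_superset (mem_nhdsWithin_of_image_mem_nhds hO he hec (he ▸ ⟨hu₀, hxO⟩)
    hmaps'.image_subset h1) (image_mono inter_subset_left)

/-- Invariance of domain for maps from a `d`-manifold to `ℝᵈ`. -/
theorem image_mem_nhds_of_mem_nhdsWithin [ChartedSpace (EuclideanSpace ℝ (Fin d)) C]
    {x₀ : X} (hx₀ : x₀ ∈ C) {U : Set X} (hUo : IsOpen U) (hxU : x₀ ∈ U) {g : X → Fin d → ℝ}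
    (hc : ContinuousOn g (C ∩ U)) (hinj : InjOn g (C ∩ U)) : g '' (C ∩ U) ∈ 𝓝 (g x₀) := by
  obtain ⟨e, O, hO, hxO, he, hto, hec, hesc⟩ := exists_local_chart (d := d) hx₀
  have hxs : x₀ ∈ e.source := he ▸ ⟨hx₀, hxO⟩
  set T := e.target ∩ e.symm ⁻¹' U
  have hT : T ∈ 𝓝 (e x₀) := by
    have hx := hto.mem_nhds (e.map_source hxs)
    refine inter_mem hx (hesc.continuousAt hx ?_)
    rw [e.left_inv hxs]
    exact hUo.mem_nhds hxU
  have hmaps : MapsTo e.symm T (C ∩ U) := by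
    intro y hy
    have := e.map_target hy.1
    rw [he] at this
    exact ⟨this.1, hy.2⟩
  have h1 := image_mem_nhds_of_injOn hT (hc.comp (hesc.mono inter_subset_left) hmaps)
    (hinj.comp (e.symm.injOn.mono inter_subset_left) hmaps)
  rw [Function.comp_apply, e.left_inv hxs, image_comp] at h1
  exact mem_of_superset h1 (image_mono hmaps.image_subset)

end Charts

/-! ### Local structure of triangulated manifolds. -/

namespace PreAbstractSimplicialComplex

variable {V : Type*} {K : PreAbstractSimplicialComplex V}

lemma mem_carrier {x : V → ℝ} : x ∈ K.carrier ↔ ∃ s ∈ K.faces, x ∈ face s := Iff.rfl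

lemma mem_faces_of_subset {s t : Finset V} (ht : t ∈ K.faces) (hst : s ⊆ t) (hs : s.Nonempty) :
    s ∈ K.faces := (K.isRelLowerSet_faces ht).2 hst hs

lemma nonempty_of_mem_faces {s : Finset V} (hs : s ∈ K.faces) : s.Nonempty :=
  (K.isRelLowerSet_faces hs).1

/-- The point of a simplex with equal barycentric coordinates. -/
noncomputable def centroid [DecidableEq V] (s : Finset V) : V → ℝ :=
  fun v => if v ∈ s then (s.card : ℝ)⁻¹ else 0

lemma centroid_mem_face [DecidableEq V] {s : Finset V} (hs : s.Nonempty) :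
    centroid s ∈ face s := by
  have : (s.card : ℝ) ≠ 0 := by exact_mod_cast hs.card_pos.ne'
  refine ⟨fun v => ?_, fun v hv => if_neg hv, ?_⟩
  · unfold centroid; split_ifs <;> positivity
  · simp [centroid, this]

/-- A neighborhood in the carrier of a point of a simplex meets the interior of the simplex. -/
lemma exists_mem_ne_zero {s : Finset V} (hs : s ∈ K.faces) {x₀ : V → ℝ} (hx₀ : x₀ ∈ face s)
    {M : Set (V → ℝ)} (hM : M ∈ 𝓝[K.carrier] x₀) : ∃ y ∈ M, ∀ v ∈ s, y v ≠ 0 := by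
  classical
  have hne := nonempty_of_mem_faces hs
  have hb := centroid_mem_face hne
  set γ : ℝ → V → ℝ := fun η => (1 - η) • x₀ + η • centroid s with hγ
  have hγc : Continuous γ := by fun_prop
  have hγ0 : γ 0 = x₀ := by simp [hγ]
  have hIcc : Ioo (0 : ℝ) 1 ∈ 𝓝[>] (0 : ℝ) := Ioo_mem_nhdsGT one_pos
  have hmem : ∀ η ∈ Ioo (0 : ℝ) 1, γ η ∈ face s := fun η hη =>
    convex_face s hx₀ hb (by linarith [hη.2]) hη.1.le (by ring)
  have hlim : Tendsto γ (𝓝[>] 0) (𝓝[K.carrier] x₀) := by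
    refine tendsto_nhdsWithin_iff.2 ⟨?_, ?_⟩
    · have := hγc.tendsto 0
      rw [hγ0] at this
      exact this.mono_left nhdsWithin_le_nhds
    · filter_upwards [hIcc] with η hη
      exact mem_carrier.2 ⟨s, hs, hmem η hη⟩
  obtain ⟨η, hηM, hη⟩ := ((hlim.eventually hM).and hIcc).exists
  refine ⟨γ η, hηM, fun v hv => ne_of_gt ?_⟩
  have h1 : 0 ≤ (1 - η) * x₀ v := mul_nonneg (by linarith [hη.2]) (hx₀.1 v)
  have h2 : 0 < η * (s.card : ℝ)⁻¹ := mul_pos hη.1 (inv_pos.2 (by exact_mod_cast hne.card_pos))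
  simp only [hγ, Pi.add_apply, Pi.smul_apply, smul_eq_mul, centroid, if_pos hv]
  linarith

variable {d : ℕ}

lemma exists_injOn_fin (hd : 1 ≤ d) {s : Finset V} (hs : s.card ≤ d) :
    ∃ ι : V → Fin d, InjOn ι s := by
  have : Nonempty (Fin d) := ⟨⟨0, hd⟩⟩
  obtain ⟨ι, -, hι⟩ := s.finite_toSet.exists_injOn_of_encard_le (t := (univ : Set (Fin d)))
    (by simpa using hs)
  exact ⟨ι, hι⟩

/-- If all simplices around `s` lie in a simplex of dimension at most `d` of a `d`-manifold, then
`s` has dimension at least `d`. -/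
lemma lt_card_of_forall_subset [ChartedSpace (EuclideanSpace ℝ (Fin d)) K.carrier] (hd : 1 ≤ d)
    {s t : Finset V} (hs : s ∈ K.faces) (hst : ∀ u ∈ K.faces, s ⊆ u → u ⊆ t)
    (ht : t.card ≤ d + 1) : d < s.card := by
  classical
  have hst' : s ⊆ t := hst s hs subset_rfl
  obtain ⟨v₀, hv₀⟩ := nonempty_of_mem_faces hs
  obtain ⟨ι, hι⟩ := exists_injOn_fin hd (s := t.erase v₀)
    (by rw [Finset.card_erase_of_mem (hst' hv₀)]; omega)
  -- The barycentric coordinates of `t` other than that of `v₀`, placed in `ℝᵈ` by `ι`. The omitted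
  -- one is determined by the sum, so `g` is injective on points supported in `t`.
  set g : (V → ℝ) → Fin d → ℝ := fun x i => ∑ v ∈ t.erase v₀ with ι v = i, x v with hg
  have hgι : ∀ x, ∀ v ∈ t.erase v₀, g x (ι v) = x v := by
    intro x v hv
    change ∑ w ∈ t.erase v₀ with ι w = ι v, x w = x v
    rw [Finset.sum_eq_single v]
    · intro w hw hwv
      obtain ⟨hw1, hw2⟩ := Finset.mem_filter.1 hw
      exact absurd (hι hw1 hv hw2) hwv
    · intro h; simp_all
  set U : Set (V → ℝ) := {x | ∀ v ∈ s, 0 < x v} with hU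
  have hUo : IsOpen U := by
    have : U = ⋂ v ∈ s, {x | 0 < x v} := by ext; simp [hU]
    rw [this]
    exact isOpen_biInter_finset fun v _ => isOpen_lt continuous_const (continuous_apply v)
  have hcard : 0 < s.card := Finset.card_pos.2 ⟨v₀, hv₀⟩
  have hxU : centroid s ∈ U := fun v hv => by
    rw [centroid, if_pos hv]; positivity
  have hsupp : ∀ x ∈ K.carrier ∩ U, x ∈ face t := by
    rintro x ⟨⟨u, hu, hxu⟩, hx⟩
    refine face_mono (hst u hu fun v hv => ?_) hxu
    by_contra h
    exact (hx v hv).ne' (hxu.2.1 v h)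
  have hxC : centroid s ∈ K.carrier := mem_carrier.2 ⟨s, hs, centroid_mem_face ⟨v₀, hv₀⟩⟩
  have hg0 : ∀ x ∈ K.carrier ∩ U, ∀ i, 0 ≤ g x i := fun x hx i =>
    Finset.sum_nonneg fun v _ => (hsupp x hx).1 v
  have hinj : InjOn g (K.carrier ∩ U) := by
    intro x hx y hy hxy
    have h1 : ∀ v ∈ t.erase v₀, x v = y v := fun v hv => by rw [← hgι x v hv, hxy, hgι y v hv]
    have hx1 := (hsupp x hx).2.2
    have hy1 := (hsupp y hy).2.2
    rw [← Finset.add_sum_erase t _ (hst' hv₀)] at hx1 hy1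
    rw [Finset.sum_congr rfl h1] at hx1
    funext v
    by_cases hv : v ∈ t
    · by_cases hvv : v = v₀
      · subst hvv; linarith
      · exact h1 v (Finset.mem_erase.2 ⟨hvv, hv⟩)
    · rw [(hsupp x hx).2.1 v hv, (hsupp y hy).2.1 v hv]
  have hnhds := image_mem_nhds_of_mem_nhdsWithin hxC hUo hxU
    (by fun_prop : Continuous g).continuousOn hinj
  -- For a slot `i` not used by `s`, the image lies in the half-space `0 ≤ y i` with the image of
  -- the centroid on its boundary, so it is no neighborhood of that point.
  have hpos : ∀ i, ∃ v ∈ s.erase v₀, ι v = i := by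
    intro i
    by_contra! hcon
    have hi0 : g (centroid s) i = 0 := by
      refine Finset.sum_eq_zero fun v hv => ?_
      obtain ⟨hv, h⟩ := Finset.mem_filter.1 hv
      refine if_neg fun hvs => hcon v ?_ h
      exact Finset.mem_erase.2 ⟨(Finset.mem_erase.1 hv).1, hvs⟩
    have hlim : Tendsto (fun η : ℝ => g (centroid s) - η • Pi.single i (1 : ℝ)) (𝓝[>] 0)
        (𝓝 (g (centroid s))) := by
      have hc : Continuous fun η : ℝ => g (centroid s) - η • Pi.single i (1 : ℝ) := by fun_prop
      have := hc.tendsto 0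
      rw [zero_smul, sub_zero] at this
      exact this.mono_left nhdsWithin_le_nhds
    obtain ⟨η, ⟨x, hx, hxη⟩, hη⟩ := ((hlim.eventually hnhds).and self_mem_nhdsWithin).exists
    have h1 := hg0 x hx i
    rw [hxη] at h1
    simp [hi0] at h1
    exact absurd hη (not_lt.2 h1)
  have hle : (Finset.univ : Finset (Fin d)).card ≤ (s.erase v₀).card := by
    refine (Finset.card_le_card fun i _ => ?_).trans (Finset.card_image_le (f := ι))
    exact Finset.mem_image.2 (hpos i)
  rw [Finset.card_univ, Fintype.card_fin, Finset.card_erase_of_mem hv₀] at hle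
  omega

/-- Two `d`-simplices of a `d`-manifold with a common facet fill a neighborhood of the interior of
this facet. -/
lemma subset_or_subset_of_facet_subset [ChartedSpace (EuclideanSpace ℝ (Fin d)) K.carrier]
    [DecidableEq V] (hd : 1 ≤ d) {s : Finset V} {a b : V} (hs : s.card = d) (ha : a ∉ s)
    (hb : b ∉ s) (hab : a ≠ b) (has : insert a s ∈ K.faces) (hbs : insert b s ∈ K.faces)
    {u : Finset V} (hu : u ∈ K.faces) (hsu : s ⊆ u) : u ⊆ insert a s ∨ u ⊆ insert b s := by
  obtain ⟨v₀, hv₀⟩ : s.Nonempty := Finset.card_pos.1 (by omega)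
  obtain ⟨ι, hι⟩ := exists_injOn_fin hd hs.le
  have hsurj : ∀ i, ∃ v ∈ s, ι v = i := by
    have : s.image ι = Finset.univ := by
      rw [← Finset.card_eq_iff_eq_univ, Finset.card_image_of_injOn hι, hs, Fintype.card_fin]
    intro i
    exact Finset.mem_image.1 (this ▸ Finset.mem_univ i)
  have hav : a ≠ v₀ := fun h => ha (h ▸ hv₀)
  have hbv : b ≠ v₀ := fun h => hb (h ▸ hv₀)
  -- The weight of `v₀` is what the others leave over, so its slot is free to cross the facet: the
  -- positive part of `y (ι v₀)` is the weight of `a`, the negative part that of `b`.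
  set h : (Fin d → ℝ) → V → ℝ := fun y v =>
    if v = a then max (y (ι v₀)) 0 else if v = b then max (-y (ι v₀)) 0 else
    if v = v₀ then 1 - |y (ι v₀)| - ∑ w ∈ s.erase v₀, y (ι w) else
    if v ∈ s then y (ι v) else 0 with hh
  have hcont : Continuous h := by
    refine continuous_pi fun v => ?_
    simp only [hh]
    split_ifs <;> fun_prop
  have hya : ∀ y, h y a = max (y (ι v₀)) 0 := fun y => if_pos rfl
  have hyb : ∀ y, h y b = max (-y (ι v₀)) 0 := fun y => by simp [hh, hab.symm]
  have hyv₀ : ∀ y, h y v₀ = 1 - |y (ι v₀)| - ∑ w ∈ s.erase v₀, y (ι w) := fun y => by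
    simp [hh, hav.symm, hbv.symm]
  have hys : ∀ y, ∀ v ∈ s.erase v₀, h y v = y (ι v) := by
    intro y v hv
    obtain ⟨hv1, hv2⟩ := Finset.mem_erase.1 hv
    have h1 : v ≠ a := fun h => ha (h ▸ hv2)
    have h2 : v ≠ b := fun h => hb (h ▸ hv2)
    simp [hh, h1, h2, hv1, hv2]
  have hyo : ∀ y v, v ≠ a → v ≠ b → v ∉ s → h y v = 0 := by
    intro y v h1 h2 h3
    have : v ≠ v₀ := fun h => h3 (h ▸ hv₀)
    simp [hh, h1, h2, h3, this]
  have hysum : ∀ y, ∑ v ∈ s, h y v = 1 - |y (ι v₀)| := by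
    intro y
    rw [← Finset.add_sum_erase s _ hv₀, hyv₀, Finset.sum_congr rfl (hys y)]
    ring
  set U : Set (Fin d → ℝ) := {y | ∀ v ∈ s, 0 < h y v} with hU
  have hUo : IsOpen U := by
    have : U = ⋂ v ∈ s, {y | 0 < h y v} := by ext; simp [hU]
    rw [this]
    exact isOpen_biInter_finset fun v _ =>
      isOpen_lt continuous_const ((continuous_apply v).comp hcont)
  have hnonneg : ∀ y ∈ U, ∀ v, 0 ≤ h y v := by
    intro y hy v
    by_cases hv : v ∈ s
    · exact (hy v hv).le
    · by_cases h1 : v = a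
      · rw [h1, hya]; exact le_max_right _ _
      · by_cases h2 : v = b
        · rw [h2, hyb]; exact le_max_right _ _
        · exact (hyo y v h1 h2 hv).ge
  have hmem : ∀ y ∈ U, h y ∈ face (insert a s) ∨ h y ∈ face (insert b s) := by
    intro y hy
    rcases le_total 0 (y (ι v₀)) with hz | hz
    · refine Or.inl ⟨hnonneg y hy, fun v hv => ?_, ?_⟩
      · rw [Finset.mem_insert, not_or] at hv
        by_cases h2 : v = b
        · rw [h2, hyb]; exact max_eq_right (by linarith)
        · exact hyo y v hv.1 h2 hv.2
      · rw [Finset.sum_insert ha, hysum, hya, max_eq_left hz, abs_of_nonneg hz]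
        ring
    · refine Or.inr ⟨hnonneg y hy, fun v hv => ?_, ?_⟩
      · rw [Finset.mem_insert, not_or] at hv
        by_cases h2 : v = a
        · rw [h2, hya]; exact max_eq_right hz
        · exact hyo y v h2 hv.1 hv.2
      · rw [Finset.sum_insert hb, hysum, hyb, max_eq_left (by linarith), abs_of_nonpos hz]
        ring
  have hinj : InjOn h U := by
    intro y _ z _ hyz
    have h0 : y (ι v₀) = z (ι v₀) := by
      have h1 := congrFun hyz a
      have h2 := congrFun hyz b
      rw [hya, hya] at h1
      rw [hyb, hyb] at h2
      have h3 := max_zero_sub_max_neg_zero_eq_self (y (ι v₀))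
      have h4 := max_zero_sub_max_neg_zero_eq_self (z (ι v₀))
      rw [← h3, ← h4, h1, h2]
    funext i
    obtain ⟨v, hv, rfl⟩ := hsurj i
    by_cases hvv : v = v₀
    · rw [hvv, h0]
    · have hv' := Finset.mem_erase.2 ⟨hvv, hv⟩
      rw [← hys y v hv', ← hys z v hv', hyz]
  -- The parameter of the centroid of `s`: each of its `d` vertices, including `v₀` by the
  -- remainder, has weight `1 / d`.
  set y₀ : Fin d → ℝ := fun i => if i = ι v₀ then 0 else (d : ℝ)⁻¹ with hy₀
  have hd0 : (0 : ℝ) < d := by exact_mod_cast hd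
  have hy₀s : ∀ v ∈ s.erase v₀, y₀ (ι v) = (d : ℝ)⁻¹ := by
    intro v hv
    obtain ⟨hv1, hv2⟩ := Finset.mem_erase.1 hv
    exact if_neg fun h => hv1 (hι hv2 hv₀ h)
  have hy₀z : y₀ (ι v₀) = 0 := if_pos rfl
  have hy₀U : y₀ ∈ U := by
    intro v hv
    by_cases hvv : v = v₀
    · rw [hvv, hyv₀, hy₀z, Finset.sum_congr rfl hy₀s, Finset.sum_const,
        Finset.card_erase_of_mem hv₀, hs, nsmul_eq_mul, Nat.cast_sub hd, abs_zero]
      have : 1 - 0 - ((d : ℝ) - (1 : ℕ)) * (d : ℝ)⁻¹ = (d : ℝ)⁻¹ := by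
        field_simp; push_cast; ring
      rw [this]
      positivity
    · have hv' := Finset.mem_erase.2 ⟨hvv, hv⟩
      rw [hys _ v hv', hy₀s v hv']
      positivity
  have hmaps : MapsTo h U K.carrier := fun y hy => by
    rcases hmem y hy with h1 | h1
    · exact mem_carrier.2 ⟨_, has, h1⟩
    · exact mem_carrier.2 ⟨_, hbs, h1⟩
  have hM := image_mem_nhdsWithin_of_injOn (hUo.mem_nhds hy₀U) hcont.continuousOn hinj hmaps
  have hx₀ : h y₀ ∈ face u := by
    have h0 : h y₀ ∈ face s := by
      refine ⟨hnonneg y₀ hy₀U, fun v hv => ?_, by rw [hysum, hy₀z]; simp⟩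
      by_cases h1 : v = a
      · rw [h1, hya, hy₀z, max_self]
      · by_cases h2 : v = b
        · rw [h2, hyb, hy₀z, neg_zero, max_self]
        · exact hyo y₀ v h1 h2 hv
    exact face_mono hsu h0
  obtain ⟨_, ⟨y, hy, rfl⟩, hyu⟩ := exists_mem_ne_zero hu hx₀ hM
  refine (hmem y hy).imp (fun h1 v hv => ?_) fun h1 v hv => ?_ <;>
  · by_contra hcon
    exact hyu v hv (h1.2.1 v hcon)

variable {J : PreAbstractSimplicialComplex V}

/-- Extension by zero from the vertices of a complex. -/
noncomputable def extendZero (S : Set V) (x : S → ℝ) (v : V) : ℝ :=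
  open Classical in if h : v ∈ S then x ⟨v, h⟩ else 0

lemma continuous_extendZero (S : Set V) : Continuous (extendZero S) := by
  refine continuous_pi fun v => ?_
  unfold extendZero
  split_ifs
  · exact continuous_apply _
  · exact continuous_const

lemma extendZero_apply {S : Set V} (x : S → ℝ) (v : S) : extendZero S x v = x v := by
  simp [extendZero]

lemma extendZero_injective (S : Set V) : Function.Injective (extendZero S) := fun x y h => by
  funext v
  rw [← extendZero_apply x v, h, extendZero_apply]

lemma extendZero_mem_face {S : Set V} {t : Finset S} {x : S → ℝ} (hx : x ∈ face t) :
    extendZero S x ∈ face (t.map (Function.Embedding.subtype _)) := by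
  classical
  refine ⟨fun v => ?_, fun v hv => ?_, ?_⟩
  · unfold extendZero
    split_ifs
    · exact hx.1 _
    · exact le_rfl
  · unfold extendZero
    split_ifs with h
    · exact hx.2.1 _ fun hv' => hv (Finset.mem_map.2 ⟨_, hv', rfl⟩)
    · rfl
  · rw [Finset.sum_map, ← hx.2.2]
    exact Finset.sum_congr rfl fun v _ => extendZero_apply x v

/-- A family of `d`-simplices with common vertex `p` in a `d`-manifold, whose link of `p` is a
mod 2 cycle, covers all simplices at `p`. -/
lemma exists_superset_of_even_star [ChartedSpace (EuclideanSpace ℝ (Fin d)) K.carrier]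
    {S : Set V} [Fintype S] [DecidableEq S]
    (A : Finset (Finset S)) (hne : A.Nonempty) (p : S)
    (hAK : ∀ t ∈ A, t.map (Function.Embedding.subtype _) ∈ K.faces)
    (hA : ∀ t ∈ A, t.card = d + 1) (hp : ∀ t ∈ A, p ∈ t)
    (heven : ∀ s : Finset S, p ∈ s → s.card = d → Even ({t ∈ A | s ⊆ t} : Finset _).card)
    {u : Finset V} (hu : u ∈ K.faces) (hpu : (p : V) ∈ u) :
    ∃ t ∈ A, u ⊆ t.map (Function.Embedding.subtype _) := by
  classical
  set q : S → ℝ := Pi.single p 1 with hq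
  have hqt : ∀ t ∈ A, q ∈ face t := fun t ht => single_mem_face (hp t ht)
  have hext : ∀ x ∈ polyhedron A, extendZero S x ∈ K.carrier := by
    intro x hx
    obtain ⟨t, ht, hxt⟩ := mem_polyhedron.1 hx
    exact mem_carrier.2 ⟨_, hAK t ht, extendZero_mem_face hxt⟩
  have hqA : q ∈ polyhedron A := by
    obtain ⟨t, ht⟩ := hne
    exact mem_polyhedron.2 ⟨t, ht, hqt t ht⟩
  obtain ⟨e, O, hO, hqO, he, -, hec, -⟩ := exists_local_chart (d := d) (hext q hqA)
  obtain ⟨ε, hε, hεO⟩ := Metric.nhds_basis_closedBall.mem_iff.1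
    ((hO.preimage (continuous_extendZero S)).mem_nhds hqO)
  -- Shrinking the cone towards its apex by `η` brings it into the chart domain; `η ≤ 1` keeps each
  -- point in its simplex, and points of a simplex are at sup distance at most 1 from the apex.
  set η := min ε 1 with hη
  have hη0 : 0 < η := lt_min hε one_pos
  set c : (S → ℝ) → S → ℝ := fun x => (1 - η) • q + η • x with hc
  have hcc : Continuous c := by fun_prop
  have hcA : MapsTo c (polyhedron A) (polyhedron A) := by
    intro x hx
    obtain ⟨t, ht, hxt⟩ := mem_polyhedron.1 hx
    refine mem_polyhedron.2 ⟨t, ht, convex_face t (hqt t ht) hxt ?_ hη0.le (by ring)⟩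
    linarith [min_le_right ε 1]
  have hcq : c q = q := by
    rw [hc]
    simp only [← add_smul, sub_add_cancel, one_smul]
  have hcε : ∀ x ∈ polyhedron A, c x ∈ Metric.closedBall q ε := by
    intro x hx
    have h1 : c x - q = η • (x - q) := by
      ext v; simp [hc]; ring
    rw [mem_closedBall_iff_norm, h1, norm_smul, Real.norm_of_nonneg hη0.le]
    refine (mul_le_of_le_one_right hη0.le ?_).trans (min_le_left _ _)
    obtain ⟨t, ht, hxt⟩ := mem_polyhedron.1 hx
    refine (pi_norm_le_iff_of_nonneg zero_le_one).2 fun v => ?_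
    rw [Pi.sub_apply, Real.norm_eq_abs, abs_le]
    have := hxt.1 v
    have := le_one_of_mem_face hxt v
    have := (hqt t ht).1 v
    have := le_one_of_mem_face (hqt t ht) v
    constructor <;> linarith
  set f : (S → ℝ) → V → ℝ := fun x => extendZero S (c x) with hf
  have hfe : MapsTo f (polyhedron A) e.source := fun x hx =>
    he ▸ ⟨hext _ (hcA hx), hεO (hcε x hx)⟩
  have hfc : Continuous f := (continuous_extendZero S).comp hcc
  have hfinj : Function.Injective f := by
    intro x y hxy
    have h1 := extendZero_injective S hxy
    exact smul_right_injective _ hη0.ne' (add_left_cancel h1)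
  have h := image_cone_mem_nhds A hne p hA hp heven (hec.comp hfc.continuousOn hfe)
    (e.injOn.comp hfinj.injOn hfe)
  rw [← hq, Function.comp_apply, image_comp] at h
  have hM := mem_nhdsWithin_of_image_mem_nhds hO he hec (hfe hqA) hfe.image_subset h
  have hfq : f q ∈ face u := by
    have h1 := extendZero_mem_face (single_mem_face (Finset.mem_singleton_self p))
    rw [hf]
    simp only [hcq]
    exact face_mono (by simpa using hpu) h1
  obtain ⟨_, ⟨x, hx, rfl⟩, hxu⟩ := exists_mem_ne_zero hu hfq hM
  obtain ⟨t, ht, hxt⟩ := mem_polyhedron.1 (hcA hx)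
  refine ⟨t, ht, fun v hv => ?_⟩
  by_contra hcon
  exact hxu v hv ((extendZero_mem_face hxt).2.1 v hcon)

/-! ### Links and the two implications. -/

section Links

variable [DecidableEq V]

lemma mem_link_faces {p : V} {t : Finset V} :
    t ∈ (K.link p).faces ↔ t.Nonempty ∧ p ∉ t ∧ insert p t ∈ K.faces := by
  constructor
  · rintro ⟨h1, h2, h3⟩
    exact ⟨h1, h2, by rwa [Finset.cons_eq_insert] at h3⟩
  · rintro ⟨h1, h2, h3⟩
    exact ⟨h1, h2, by rwa [Finset.cons_eq_insert]⟩

lemma erase_mem_link_simplices {p : V} {s : Finset V} (hs : s ∈ K.faces) (hp : p ∈ s) :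
    s.erase p ∈ (K.link p).simplices := by
  rcases (s.erase p).eq_empty_or_nonempty with h | h
  · exact Or.inl h
  · exact Or.inr (mem_link_faces.2 ⟨h, Finset.notMem_erase p s, by rwa [Finset.insert_erase hp]⟩)

/-- Inserting `p` is a bijection between the two families; `1 ≤ d` makes the truncated `d - 1 + 1`
equal to `d` and keeps `t.erase p` nonempty. -/
lemma encard_link_cofaces (hd : 1 ≤ d) {p : V} {s : Finset V} (hp : p ∉ s) :
    {t | t ∈ (K.link p).faces ∧ s ⊆ t ∧ t.card = d - 1 + 1}.encard =
      {t | t ∈ K.faces ∧ insert p s ⊆ t ∧ t.card = d + 1}.encard := by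
  have hinj : InjOn (fun t : Finset V => insert p t)
      {t | t ∈ (K.link p).faces ∧ s ⊆ t ∧ t.card = d - 1 + 1} := by
    rintro t ⟨ht, -⟩ u ⟨hu, -⟩ htu
    have h1 := (mem_link_faces.1 ht).2.1
    have h2 := (mem_link_faces.1 hu).2.1
    rw [← Finset.erase_insert h1, ← Finset.erase_insert h2]
    exact congrArg (Finset.erase · p) htu
  rw [← hinj.encard_image]
  congr 1
  ext t
  constructor
  · rintro ⟨u, ⟨hu, hsu, huc⟩, rfl⟩
    obtain ⟨-, h1, h2⟩ := mem_link_faces.1 hu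
    refine ⟨h2, Finset.insert_subset_insert p hsu, ?_⟩
    simp only [Finset.card_insert_of_notMem h1, huc]
    omega
  · rintro ⟨ht, hst, htc⟩
    have hpt : p ∈ t := hst (Finset.mem_insert_self p s)
    have hc : (t.erase p).card = d := by rw [Finset.card_erase_of_mem hpt, htc]; rfl
    refine ⟨t.erase p, ⟨mem_link_faces.2 ⟨?_, Finset.notMem_erase p t, ?_⟩, ?_, ?_⟩,
      Finset.insert_erase hpt⟩
    · exact Finset.card_pos.1 (by omega)
    · rwa [Finset.insert_erase hpt]
    · exact Finset.subset_erase.2 ⟨(Finset.subset_insert p s).trans hst, hp⟩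
    · omega

end Links

/-- The links of a complex whose carrier is a `d`-manifold are pseudomanifolds. -/
theorem hasGoodLinks_of_chartedSpace [ChartedSpace (EuclideanSpace ℝ (Fin d)) K.carrier]
    (hd : 1 ≤ d) (hfin : K.faces.Finite) : K.HasGoodLinks d := by
  classical
  have hdim : ∀ s ∈ K.faces, s.card ≤ d + 1 := by
    intro s hs
    by_contra! hcard
    -- Among `d + 2` vertices of a too large simplex, `d` span a common facet `r` of two
    -- `d`-simplices. The large simplex contains `r`, so it would have to lie in one of the two.
    obtain ⟨t, hts, htc⟩ := Finset.exists_subset_card_eq (show d + 2 ≤ s.card by omega)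
    obtain ⟨r, hrt, hrc⟩ := Finset.exists_subset_card_eq (show d ≤ t.card by omega)
    have h2 : (t \ r).card = 2 := by rw [Finset.card_sdiff_of_subset hrt]; omega
    obtain ⟨a, b, hab, hr⟩ := Finset.card_eq_two.1 h2
    have ha : a ∈ t \ r := by simp [hr]
    have hb : b ∈ t \ r := by simp [hr]
    rw [Finset.mem_sdiff] at ha hb
    have hface : ∀ v ∈ t, insert v r ∈ K.faces := fun v hv =>
      mem_faces_of_subset hs ((Finset.insert_subset hv hrt).trans hts) (Finset.insert_nonempty v r)
    rcases subset_or_subset_of_facet_subset hd hrc ha.2 hb.2 hab (hface a ha.1) (hface b hb.1) hs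
      (hrt.trans hts) with h | h
    · have := h (hts hb.1)
      simp [hab.symm, hb.2] at this
    · have := h (hts ha.1)
      simp [hab, ha.2] at this
  have hpure : ∀ s ∈ K.faces, ∃ t ∈ K.faces, s ⊆ t ∧ t.card = d + 1 := by
    intro s hs
    obtain ⟨t, hst, ht⟩ := hfin.exists_le_maximal hs
    refine ⟨t, ht.prop, hst, le_antisymm (hdim t ht.prop) ?_⟩
    exact lt_card_of_forall_subset hd ht.prop (fun u hu htu => ht.le_of_ge hu htu) (hdim t ht.prop)
  have htwo : ∀ s ∈ K.faces, s.card = d →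
      {t | t ∈ K.faces ∧ s ⊆ t ∧ t.card = d + 1}.encard = 2 := by
    intro s hs hsc
    have hinsert : ∀ t : Finset V, s ⊆ t → t.card = d + 1 → ∃ a ∉ s, insert a s = t := by
      intro t hst htc
      exact (Finset.covBy_iff_exists_insert.1 (Finset.covBy_iff_card_sdiff_eq_one.2
        ⟨hst, by rw [Finset.card_sdiff_of_subset hst]; omega⟩))
    obtain ⟨t₁, ht₁, hst₁, htc₁⟩ := hpure s hs
    -- With a single `d`-simplex `t₁` above `s`, purity would put every simplex around `s` inside
    -- `t₁`, forcing `d < s.card`.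
    obtain ⟨t₂, ht₂, hst₂, htc₂, hne⟩ : ∃ t₂ ∈ K.faces, s ⊆ t₂ ∧ t₂.card = d + 1 ∧ t₁ ≠ t₂ := by
      by_contra! hcon
      have := lt_card_of_forall_subset hd hs (t := t₁) (fun u hu hsu => by
        obtain ⟨t, ht, hut, htc⟩ := hpure u hu
        rw [hcon t ht (hsu.trans hut) htc]
        exact hut) htc₁.le
      omega
    obtain ⟨a, ha, rfl⟩ := hinsert t₁ hst₁ htc₁
    obtain ⟨b, hb, rfl⟩ := hinsert t₂ hst₂ htc₂
    rw [encard_eq_two]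
    refine ⟨_, _, hne, Set.ext fun u => ⟨?_, ?_⟩⟩
    · rintro ⟨hu, hsu, huc⟩
      refine (subset_or_subset_of_facet_subset hd hsc ha hb (fun h => hne (by rw [h])) ht₁ ht₂
        hu hsu).imp (fun h => ?_) fun h => ?_
      · exact Finset.eq_of_subset_of_card_le h (by rw [htc₁, huc])
      · exact Finset.eq_of_subset_of_card_le h (by rw [htc₂, huc])
    · rintro (rfl | rfl)
      · exact ⟨ht₁, hst₁, htc₁⟩
      · exact ⟨ht₂, hst₂, htc₂⟩
  intro p hp
  have hins : ∀ s ∈ (K.link p).simplices, p ∉ s ∧ insert p s ∈ K.faces := by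
    rintro s (rfl | hs)
    · exact ⟨Finset.notMem_empty p, hp⟩
    · exact (mem_link_faces.1 hs).2
  refine ⟨fun s hs => ?_, fun s hs hsc => ?_⟩
  · obtain ⟨hps, hs'⟩ := hins s hs
    obtain ⟨t, ht, hst, htc⟩ := hpure _ hs'
    have hpt : p ∈ t := hst (Finset.mem_insert_self p s)
    have hc : (t.erase p).card = d := by rw [Finset.card_erase_of_mem hpt, htc]; rfl
    refine ⟨t.erase p, mem_link_faces.2 ⟨Finset.card_pos.1 (by omega), Finset.notMem_erase p t,
      by rwa [Finset.insert_erase hpt]⟩, ?_, by omega⟩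
    exact Finset.subset_erase.2 ⟨(Finset.subset_insert p s).trans hst, hps⟩
  · obtain ⟨hps, hs'⟩ := hins s hs
    rw [encard_link_cofaces hd hps]
    exact htwo _ hs' (by rw [Finset.card_insert_of_notMem hps, hsc]; omega)

/-- A subcomplex of a triangulated `d`-manifold with the same vertices, whose links are
pseudomanifolds, is the whole complex. -/
theorem eq_of_hasGoodLinks [ChartedSpace (EuclideanSpace ℝ (Fin d)) K.carrier]
    (hd : 1 ≤ d) (hfin : K.faces.Finite) (hJK : J ≤ K) (hvert : J.vertices = K.vertices)
    (hJ : J.HasGoodLinks d) : J = K := by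
  classical
  refine le_antisymm hJK fun u hu => ?_
  obtain ⟨p, hpu⟩ := nonempty_of_mem_faces hu
  have hpK : p ∈ K.vertices :=
    mem_faces_of_subset hu (Finset.singleton_subset_iff.2 hpu) (Finset.singleton_nonempty p)
  have hpJ : p ∈ J.vertices := hvert ▸ hpK
  have hfinv : K.vertices.Finite :=
    hfin.preimage (f := fun v : V => ({v} : Finset V)) Finset.singleton_injective.injOn
  have := hfinv.fintype
  set ι : K.vertices ↪ V := Function.Embedding.subtype _
  have hlift : ∀ t ∈ J.faces, ∃ t' : Finset K.vertices, t'.map ι = t := by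
    intro t ht
    refine ⟨t.subtype (· ∈ K.vertices), Finset.subtype_map_of_mem fun v hv => ?_⟩
    exact mem_faces_of_subset (hJK ht) (Finset.singleton_subset_iff.2 hv)
      (Finset.singleton_nonempty v)
  -- The `d`-simplices of `J` at `p`, over the finite type of vertices of `K`. Purity at the empty
  -- simplex of the link makes `A` nonempty, and a `(d - 1)`-simplex at `p` lies in two members of
  -- `A` or, if not in `J`, in none.
  set A : Finset (Finset K.vertices) :=
    {t | t.map ι ∈ J.faces ∧ t.card = d + 1 ∧ ⟨p, hpK⟩ ∈ t} with hA
  have hmemA : ∀ t, t ∈ A ↔ t.map ι ∈ J.faces ∧ t.card = d + 1 ∧ ⟨p, hpK⟩ ∈ t := by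
    intro t; simp [hA]
  have hι : ∀ t : Finset K.vertices, p ∈ t.map ι ↔ ⟨p, hpK⟩ ∈ t := fun t =>
    Finset.mem_map' ι (a := ⟨p, hpK⟩)
  obtain ⟨hpure, htwo⟩ := hJ p hpJ
  obtain ⟨t, ht, hut⟩ := exists_superset_of_even_star (K := K) (d := d) A
    (by
      obtain ⟨t, ht, -, htc⟩ := hpure ∅ (Or.inl rfl)
      obtain ⟨-, hpt, htJ⟩ := mem_link_faces.1 ht
      obtain ⟨t', ht'⟩ := hlift _ htJ
      refine ⟨t', (hmemA t').2 ⟨ht' ▸ htJ, ?_, ?_⟩⟩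
      · rw [← Finset.card_map ι, ht', Finset.card_insert_of_notMem hpt]
        omega
      · rw [← hι, ht']
        exact Finset.mem_insert_self p t)
    ⟨p, hpK⟩ (fun t ht => hJK ((hmemA t).1 ht).1) (fun t ht => ((hmemA t).1 ht).2.1)
    (fun t ht => ((hmemA t).1 ht).2.2)
    (by
      intro s hps hsc
      by_cases hs : s.map ι ∈ J.faces
      · have hps' := (hι s).2 hps
        have h2 := htwo _ (erase_mem_link_simplices hs hps')
          (by rw [Finset.card_erase_of_mem hps', Finset.card_map, hsc])
        rw [encard_link_cofaces hd (Finset.notMem_erase p _), Finset.insert_erase hps'] at h2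
        have himage : (Finset.map ι) '' ({t ∈ A | s ⊆ t} : Finset _) =
            {t | t ∈ J.faces ∧ s.map ι ⊆ t ∧ t.card = d + 1} := by
          ext t
          constructor
          · rintro ⟨t', ht', rfl⟩
            obtain ⟨h1, h3⟩ := Finset.mem_filter.1 ht'
            obtain ⟨h4, h5, -⟩ := (hmemA t').1 h1
            exact ⟨h4, Finset.map_subset_map.2 h3, by rw [Finset.card_map, h5]⟩
          · rintro ⟨h1, h3, h4⟩
            obtain ⟨t', rfl⟩ := hlift t h1
            have h5 := Finset.map_subset_map.1 h3
            rw [Finset.card_map] at h4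
            exact ⟨t', Finset.mem_coe.2 (Finset.mem_filter.2
              ⟨(hmemA t').2 ⟨h1, h4, h5 hps⟩, h5⟩), rfl⟩
        rw [← himage, (Finset.map_injective ι).injOn.encard_image,
          encard_coe_eq_coe_finsetCard] at h2
        have h3 : ({t ∈ A | s ⊆ t} : Finset _).card = 2 := by exact_mod_cast h2
        rw [h3]
        exact even_two
      · have : ({t ∈ A | s ⊆ t} : Finset _) = ∅ := by
          refine Finset.filter_eq_empty_iff.2 fun t ht hst => hs ?_
          exact mem_faces_of_subset ((hmemA t).1 ht).1 (Finset.map_subset_map.2 hst)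
            (Finset.Nonempty.map ⟨_, hps⟩)
        rw [this]
        simp)
    hu hpu
  exact mem_faces_of_subset ((hmemA t).1 ht).1 hut ⟨p, hpu⟩

end PreAbstractSimplicialComplex

end Manifolds

theorem mainTheorem5 {V : Type*} (d : ℕ) (hd : 1 ≤ d)
    (K J : PreAbstractSimplicialComplex V) (hK : K.IsTorusTriangulation d)
    (hJK : J ≤ K) (hvert : J.vertices = K.vertices) :
    J = K ↔ J.HasGoodLinks d := by
  obtain ⟨_⟩ := hK.manifold
  refine ⟨?_, PreAbstractSimplicialComplex.eq_of_hasGoodLinks hd hK.finite hJK hvert⟩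
  rintro rfl
  exact PreAbstractSimplicialComplex.hasGoodLinks_of_chartedSpace hd hK.finite
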